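/- **Setting.** Let $x(t)$ be a real, zero-mean, Gaussian wide-sense stationary process with $\mathbb E\,x(t+\tau)x(t)=\frac1{2\pi}\int P_{xx}(\omega)e^{j\omega\tau}d\omega$, where the power spectral density $P_{xx}\ge 0$ is even, integrable and vanishes for $|\omega|>\pi W$ ($W>0$). Let $L\ge 2$ be even and let $c_1,\dots,c_q\in\{0,\dots,L-1\}$ be distinct. Put $y_i(n)=x\big((nL+c_i)/W\big)$ and $z_i=y_i\star h_i$ with the ideal fractional delay filter $h_i(k)=\operatorname{sinc}\big(\pi(k-c_i/L)\big)$, where $\operatorname{sinc}\alpha=\sin(\alpha)/\alpha$, $\operatorname{sinc}0=1$ (the convolution series converging in mean square, as a limit of symmetric partial sums). Let $z(n)=(z_1(n),\dots,z_q(n))^T$, $R_{ab}=\mathbb E\,z_a(0)z_b(0)$ and $S=S_N=\frac1N\sum_{n=0}^{N-1}z(n)z(n)^T$. Assume that the snapshots $z(0),z(1),\dots$ are independent and that $R$ is positive definite. For a symmetric $q\times q$ matrix $Q$ let $u(Q)$ be the vector of the $\binom q2+1$ entries $Q_{ab}$ with $a<b$ or $a=b=a_0$, for one fixed channel $a_0$;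 let $\Psi_{(a,b),l}=e^{-j\frac{2\pi}{L}(c_a-c_b)m_l}$ with $m_l=-L/2+1+l$, $0\le l\le L-1$; let $\tilde\Psi$, $\tilde u$ be the real parts of $\Psi$, $u$ stacked on the imaginary parts, and assume $\operatorname{rank}\tilde\Psi=L$. Put $g(Q)=(\tilde\Psi^T\tilde\Psi)^{-1}\tilde\Psi^T\tilde u(Q)$, $\hat u=u(S)$ and $\hat v_{NC}=g(S)$. Let $v_l=P_{xx}(m_l)=\frac1{2\pi}\int_{-\pi W/L}^{\pi W/L}P_{xx}(\omega-2\pi\tfrac WLm_l)\,d\omega$ for $m_l\ne L/2$ and $v_l=P_{xx}(L/2)+P_{xx}(-L/2)$ for $m_l=L/2$ (the two halves of the subband cut by the band edge). The statistical model is the Gaussian family $\mathcal N(0,Q)$, with parameter $Q$ ranging over **all** positive definite symmetric $q\times q$ matrices (no further structure is imposed on $Q$). A maximum likelihood estimate (MLE) of a function $h(Q)$ is a value of $h$ on the parameter set that maximizes the induced likelihood $\eta\mapsto\sup_{h(Q)=\eta}L(Q)$. The Cramér–Rao bound for $g$ at $Q$ is $J\,I(Q)^{-1}J^T$, where $I(Q)$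 is the Fisher information matrix of one observation with respect to the entries $Q_{ab}$, $a\le b$, and $J$ is the Jacobian of $g$ in these coordinates. **Claim.** 1. Every snapshot $z(n)$, $n\ge 0$, has the Gaussian law $\mathcal N(0,R)$. 2. $u(R)=\Psi v$ and $g(R)=v$. 3. Almost surely, for every $N\ge q$: $S$ is the unique MLE of $R$, $\hat u$ is an MLE of $u(R)$, and $\hat v_{NC}$ is an MLE of $g(R)=v$. 4. $\hat v_{NC}$ is asymptotically efficient: the scores at $R$ are square integrable, the Fisher information matrix $I(R)$ is positive definite, and $\sqrt N(\hat v_{NC}-v)$ converges in distribution, as $N\to\infty$, to $\mathcal N(0,\,J\,I(R)^{-1}J^T)$, the centred Gaussian law whose covariance is the Cramér–Rao bound. 5. If moreover $\Psi$ has rank $L$ over $\mathbb C$, then the same holds with $g$ replaced by $Q\mapsto\Psi^\dagger u(Q)=(\Psi^H\Psi)^{-1}\Psi^Hu(Q)$: $\Psi^\dagger u(R)=v$, almost surely $\Psi^\dagger\hat u$ is an MLE of it for every $N\ge q$, and $\Psi^\dagger\hat u$ is asymptotically efficient in the sense of item 4 as a vector in $\mathbb R^{2L}$ (real parts and imaginary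 parts). -/

import Mathlib

open MeasureTheory ProbabilityTheory Filter Topology

noncomputable section

namespace MultiCoset

/-! ### The random process, its power spectral density, and multi-coset sampling -/

section Sampling

variable {Ω : Type*} [MeasurableSpace Ω]

/-- `x` is a real, zero-mean, Gaussian process whose correlation `E x(s) x(t)` depends only on
`s - t` (wide-sense stationarity). -/
structure IsGaussianWSS (x : ℝ → Ω → ℝ) (μ : Measure Ω) : Prop where
  gaussian : IsGaussianProcess x μ
  zero_mean : ∀ t, ∫ ω, x t ω ∂μ = 0
  stationary : ∀ s t, ∫ ω, x s ω * x t ω ∂μ = ∫ ω, x (s - t) ω * x 0 ω ∂μ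

/-- The autocorrelation function `r_xx(τ)`. -/
def autocorr (x : ℝ → Ω → ℝ) (μ : Measure Ω) (τ : ℝ) : ℝ :=
  ∫ ω, x τ ω * x 0 ω ∂μ

/-- `P` is the power spectral density belonging to the autocorrelation function `r`: a
nonnegative even integrable function with `r(τ) = (1/2π) ∫ P(w) e^{jwτ} dw`. -/
structure IsPowerSpectralDensity (r P : ℝ → ℝ) : Prop where
  integrable : Integrable P
  nonneg : ∀ w, 0 ≤ P w
  even : ∀ w, P (-w) = P w
  fourier : ∀ τ : ℝ, (r τ : ℂ) =
    (1 / (2 * Real.pi) : ℂ) * ∫ w : ℝ, (P w : ℂ) * Complex.exp (Complex.I * w * τ)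

/-- `P` vanishes for `|w| > πW`. -/
def IsBandLimited (P : ℝ → ℝ) (W : ℝ) : Prop :=
  ∀ w, Real.pi * W < |w| → P w = 0

/-- The multi-coset samples `y_i(n) = x((nL + c_i)/W)`. -/
def cosetSample {q : ℕ} (x : ℝ → Ω → ℝ) (W : ℝ) (L : ℕ) (c : Fin q → ℕ) (i : Fin q) (n : ℤ) :
    Ω → ℝ :=
  x ((n * L + c i) / W)

/-- Impulse response of the ideal fractional delay filter which delays a sequence sampled with
period `L/W` seconds by `c_i/W` seconds, that is, by `c_i/L` samples. -/
def delayFilter {q : ℕ} (L : ℕ) (c : Fin q → ℕ) (i : Fin q) (k : ℤ) : ℝ :=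
  Real.sinc (Real.pi * (k - (c i : ℝ) / L))

/-- `z = h ⋆ y`: each `z(n)` is the mean-square limit of the symmetric partial sums of the
convolution series `∑ₘ h(m) y(n - m)`. -/
def IsFiltered (μ : Measure Ω) (h : ℤ → ℝ) (y z : ℤ → Ω → ℝ) : Prop :=
  ∀ n : ℤ, MemLp (z n) 2 μ ∧
    Tendsto (fun M : ℕ =>
      eLpNorm (fun ω => z n ω - ∑ m ∈ Finset.Icc (-(M : ℤ)) M, h m * y (n - m) ω) 2 μ)
      atTop (𝓝 0)

/-- The `n`-th snapshot `(z_1(n), …, z_q(n))` across the channels. -/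
def snapshot {q : ℕ} (z : Fin q → ℤ → Ω → ℝ) (n : ℕ) (ω : Ω) : Fin q → ℝ :=
  fun i => z i n ω

/-- The correlation matrix `R`, with entries `r_{z_a z_b}(0) = E z_a(0) z_b(0)`. -/
def corrMatrix {q : ℕ} (z : Fin q → ℤ → Ω → ℝ) (μ : Measure Ω) : Matrix (Fin q) (Fin q) ℝ :=
  Matrix.of fun a b => ∫ ω, z a 0 ω * z b 0 ω ∂μ

/-- The sample correlation matrix `S = (1/N) ∑_{n<N} z(n) z(n)ᵀ`. -/
def sampleCorr {q : ℕ} (z : Fin q → ℤ → Ω → ℝ) (N : ℕ) (ω : Ω) : Matrix (Fin q) (Fin q) ℝ :=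
  (N : ℝ)⁻¹ • ∑ n ∈ Finset.range N, Matrix.vecMulVec (snapshot z n ω) (snapshot z n ω)

end Sampling

/-! ### The linear system `u = Ψ v` -/

/-- Subband labels `m_l = -L/2 + 1 + l`, `l = 0, …, L-1` (`L` is even). -/
def subbandIdx (L : ℕ) (l : Fin L) : ℤ :=
  -((L / 2 : ℕ) : ℤ) + 1 + (l : ℕ)

/-- `P_xx(m) = (1/2π) ∫_{-πW/L}^{πW/L} P(w - 2πWm/L) dw`. -/
def subbandPower (P : ℝ → ℝ) (W : ℝ) (L : ℕ) (m : ℤ) : ℝ :=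
  (∫ w in (-(Real.pi * W / L))..(Real.pi * W / L), P (w - 2 * Real.pi * W / L * m)) /
    (2 * Real.pi)

/-- The vector `v` of subband powers, `v_l = P_xx(m_l)`. The subband `m = L/2` is cut in half by
the band edge; its other half is the subband `m = -L/2` at the opposite edge (frequencies are
taken modulo `2πW`), so the two are counted together. -/
def powerVec (P : ℝ → ℝ) (W : ℝ) (L : ℕ) : EuclideanSpace ℝ (Fin L) :=
  WithLp.toLp 2 fun l =>
    if subbandIdx L l = ((L / 2 : ℕ) : ℤ) then
      subbandPower P W L (subbandIdx L l) + subbandPower P W L (-subbandIdx L l)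
    else subbandPower P W L (subbandIdx L l)

/-- Index of the `q(q-1)/2 + 1` pairs of channels: the pairs `a < b`, and `none` for the single
pair with equal channels which is retained. -/
abbrev PairIdx (q : ℕ) := Option {p : Fin q × Fin q // p.1 < p.2}

/-- The pair belonging to an index; `a₀` is the channel that supplies the equal pair. -/
def chanPair {q : ℕ} (a₀ : Fin q) : PairIdx q → Fin q × Fin q
  | none => (a₀, a₀)
  | some p => p.1

/-- `u(R)`: the vector of the entries `R_{ab}` over the retained pairs `(a, b)`. -/
def corrVec {q : ℕ} (a₀ : Fin q) (R : Matrix (Fin q) (Fin q) ℝ) : PairIdx q → ℂ :=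
  fun i => (R (chanPair a₀ i).1 (chanPair a₀ i).2 : ℂ)

/-- `Ψ_{i,l} = exp(-j (2π/L) (c_a - c_b)_i m_l)`. -/
def Psi {q : ℕ} (L : ℕ) (c : Fin q → ℕ) (a₀ : Fin q) : Matrix (PairIdx q) (Fin L) ℂ :=
  Matrix.of fun i l => Complex.exp (-Complex.I * (2 * Real.pi / L) *
    ((c (chanPair a₀ i).1 : ℂ) - (c (chanPair a₀ i).2 : ℂ)) * (subbandIdx L l : ℂ))

/-- Real parts stacked on imaginary parts. -/
def stack {κ : Type*} (w : κ → ℂ) : κ ⊕ κ → ℝ :=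
  Sum.elim (fun i => (w i).re) (fun i => (w i).im)

/-- `Ψ̃`: the real part of `Ψ` stacked on its imaginary part. -/
def PsiTilde {q : ℕ} (L : ℕ) (c : Fin q → ℕ) (a₀ : Fin q) :
    Matrix (PairIdx q ⊕ PairIdx q) (Fin L) ℝ :=
  Matrix.of fun i l => stack (fun k => Psi L c a₀ k l) i

/-- The noncompressive solution `(Ψ̃ᵀ Ψ̃)⁻¹ Ψ̃ᵀ ũ` for the correlation matrix `R`. At
`R = S` this is the noncompressive estimate. -/
def noncompressive {q : ℕ} (L : ℕ) (c : Fin q → ℕ) (a₀ : Fin q)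
    (R : Matrix (Fin q) (Fin q) ℝ) : EuclideanSpace ℝ (Fin L) :=
  WithLp.toLp 2 ((((PsiTilde L c a₀).transpose * PsiTilde L c a₀)⁻¹ *
    (PsiTilde L c a₀).transpose).mulVec (stack (corrVec a₀ R)))

/-- The form `Ψ† u = (Ψᴴ Ψ)⁻¹ Ψᴴ u` of the noncompressive solution, for `Ψ` of full column
rank over `ℂ`. -/
def noncompressiveC {q : ℕ} (L : ℕ) (c : Fin q → ℕ) (a₀ : Fin q)
    (R : Matrix (Fin q) (Fin q) ℝ) : Fin L → ℂ :=
  (((Psi L c a₀).conjTranspose * Psi L c a₀)⁻¹ * (Psi L c a₀).conjTranspose).mulVec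
    (corrVec a₀ R)

/-! ### The Gaussian model with parameter `R`: likelihood and Cramér–Rao bound

The parameter set is the set of all positive definite real symmetric `q × q` matrices. -/

section Model

variable {q : ℕ}

/-- The density of the centred Gaussian law with covariance matrix `R`. -/
def gaussDensity (R : Matrix (Fin q) (Fin q) ℝ) (z : Fin q → ℝ) : ℝ :=
  (Real.sqrt ((2 * Real.pi) ^ q * R.det))⁻¹ * Real.exp (-(z ⬝ᵥ R⁻¹.mulVec z) / 2)

/-- The centred Gaussian law with positive definite covariance matrix `R`. -/
def gaussLaw (R : Matrix (Fin q) (Fin q) ℝ) : Measure (Fin q → ℝ) :=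
  volume.withDensity fun z => ENNReal.ofReal (gaussDensity R z)

/-- Log-likelihood of `R` given the independent observations `d 0, …, d (N-1)`. -/
def logLik (N : ℕ) (d : ℕ → Fin q → ℝ) (R : Matrix (Fin q) (Fin q) ℝ) : ℝ :=
  ∑ n ∈ Finset.range N, Real.log (gaussDensity R (d n))

/-- `R'` is a maximum likelihood estimate of the parameter `R` for the log-likelihood `ℓ`. -/
def IsMLE (ℓ : Matrix (Fin q) (Fin q) ℝ → ℝ) (R' : Matrix (Fin q) (Fin q) ℝ) : Prop :=
  R'.PosDef ∧ ∀ R : Matrix (Fin q) (Fin q) ℝ, R.PosDef → ℓ R ≤ ℓ R'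

/-- The log-likelihood induced by `ℓ` on the values `η` of a function `g` of the parameter: the
supremum of `ℓ` over all parameters `R` with `g(R) = η` (`-∞` if there are none). -/
def inducedLik {β : Type*} (ℓ : Matrix (Fin q) (Fin q) ℝ → ℝ)
    (g : Matrix (Fin q) (Fin q) ℝ → β) (η : β) : EReal :=
  ⨆ R : {R : Matrix (Fin q) (Fin q) ℝ // R.PosDef ∧ g R = η}, ((ℓ R.1 : ℝ) : EReal)

/-- `η'` is a maximum likelihood estimate of `g(R)`: it is a value of `g` on the parameter set
and maximizes the induced log-likelihood. -/
def IsMLEOf {β : Type*} (ℓ : Matrix (Fin q) (Fin q) ℝ → ℝ)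
    (g : Matrix (Fin q) (Fin q) ℝ → β) (η' : β) : Prop :=
  (∃ R : Matrix (Fin q) (Fin q) ℝ, R.PosDef ∧ g R = η') ∧
    ∀ η, inducedLik ℓ g η ≤ inducedLik ℓ g η'

/-- Indices `a ≤ b` of the free entries of a symmetric matrix. -/
abbrev SymIdx (q : ℕ) := {p : Fin q × Fin q // p.1 ≤ p.2}

/-- The symmetric matrix by which `R` moves when its free entry `(a, b)`, `a ≤ b`, moves. -/
def symDir (i : SymIdx q) : Matrix (Fin q) (Fin q) ℝ :=
  if i.1.1 = i.1.2 then Matrix.single i.1.1 i.1.1 1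
  else Matrix.single i.1.1 i.1.2 1 + Matrix.single i.1.2 i.1.1 1

/-- The score: the partial derivative of the log-density with respect to the `i`-th free entry
of `R`. -/
def score (R : Matrix (Fin q) (Fin q) ℝ) (i : SymIdx q) (z : Fin q → ℝ) : ℝ :=
  deriv (fun t : ℝ => Real.log (gaussDensity (R + t • symDir i) z)) 0

/-- The Fisher information matrix of one observation. -/
def fisher (R : Matrix (Fin q) (Fin q) ℝ) : Matrix (SymIdx q) (SymIdx q) ℝ :=
  Matrix.of fun i j => ∫ z, score R i z * score R j z ∂(gaussLaw R)

/-- The Jacobian of `g` with respect to the free entries of `R`. -/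
def jacobian {κ : Type*} (g : Matrix (Fin q) (Fin q) ℝ → EuclideanSpace ℝ κ)
    (R : Matrix (Fin q) (Fin q) ℝ) : Matrix κ (SymIdx q) ℝ :=
  Matrix.of fun k i => deriv (fun t : ℝ => g (R + t • symDir i) k) 0

/-- The Cramér–Rao bound `J I⁻¹ Jᵀ` (per observation) for the estimation of `g(R)`. -/
def cramerRao {κ : Type*} (g : Matrix (Fin q) (Fin q) ℝ → EuclideanSpace ℝ κ)
    (R : Matrix (Fin q) (Fin q) ℝ) : Matrix κ κ ℝ :=
  jacobian g R * (fisher R)⁻¹ * (jacobian g R).transpose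

/-- Asymptotic efficiency at `R` of the estimators `T N` (from `N` observations) of `g(R)`: the
Fisher information exists and is nonsingular, and `√N (T N - g(R))` converges in distribution to
the centred Gaussian law whose covariance matrix is the Cramér–Rao bound. -/
def IsAsymptoticallyEfficient {Ω κ : Type*} [MeasurableSpace Ω] [Fintype κ] [DecidableEq κ]
    (μ : Measure Ω) [IsProbabilityMeasure μ] (T : ℕ → Ω → EuclideanSpace ℝ κ)
    (g : Matrix (Fin q) (Fin q) ℝ → EuclideanSpace ℝ κ) (R : Matrix (Fin q) (Fin q) ℝ) : Prop :=
  (∀ i, MemLp (score R i) 2 (gaussLaw R)) ∧ (fisher R).PosDef ∧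
    TendstoInDistribution (fun (N : ℕ) ω => Real.sqrt N • (T N ω - g R)) atTop
      (fun e : EuclideanSpace ℝ κ => e) (fun _ => μ) (multivariateGaussian 0 (cramerRao g R))

end Model

end MultiCoset

end

/-!
The statement has a spectral half (the snapshots are Gaussian and `u = Ψ v`) and a statistical half
(estimation of a covariance matrix from independent Gaussian vectors).

**Spectral half.** Linear combinations `∑ aᵢ x(sᵢ)` correlate like the exponential sums
`∑ aᵢ e^{j w sᵢ}` in `L²(P dw)`, up to the factor `2π` (`integral_sampleSum_mul_sampleSum`). The
sequence `sinc (π (m - α))` consists of the Fourier coefficients of `e^{-2πjαs}` on `|s| < 1/2`, so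
the symmetric partial sums of its frequency response converge almost everywhere along a subsequence
(`exists_subseq_tendsto_sinc_sum`). The partial sums which define `z_a(n)` converge in mean square
by hypothesis, hence their spectral representatives form a Cauchy sequence in `L²(P dw)`, and
Fatou's lemma identifies the limit (`tendsto_eLpNorm_expSum_sub`). With `k(w)` the index of the
subband of width `2πW/L` around the frequency `w`, the limit is
`e^{j w n L / W} e^{2πj (c_a / L) k(w)}`: the delay filter removes the delay of the channel except
for a phase that is constant on each subband. Consequently
`R_{ab} = (2π)⁻¹ ∫ P(w) e^{2πj (c_a - c_b) k(w) / L} dw`, and cutting `[-πW, πW]` into subbands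
gives `u = Ψ v` (`corrVec_corrMatrix`). As `L` is even, the band edges `±πW` cut the subbands
`±L/2` in half, and the phases of these two halves agree. The rank conditions make `Ψ̃ᵀ Ψ̃` and
`Ψᴴ Ψ` invertible, so `v` is recovered from `u`. A linear functional of a snapshot is a mean square
limit of Gaussian variables, hence Gaussian, and the Cramér–Wold device gives the law `N(0, R)`
(`snapshot_map_eq_gaussLaw`).

**Maximum likelihood.** The log-likelihood is `-(N/2) (log det R + tr (R⁻¹ S))` up to a constant.
For `S = Bᵀ B` and `A = B R⁻¹ Bᵀ` the comparison of `R` with `S` becomes `tr A - log det A ≥ q` with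
equality only for `A = 1`, which is `log λ ≤ λ - 1` at the eigenvalues of `A` (`isMLE_iff_eq`). For
`N ≥ q` the matrix `S` is almost surely positive definite, as `q` independent vectors with an
absolutely continuous law are almost surely linearly independent
(`ae_average_vecMulVec_posDef`). Functions of the estimate inherit the maximum likelihood property
(`IsMLE.isMLEOf`).

**Efficiency.** The scores are linear in the fluctuations `z_a z_b - R_{ab}`, `a ≤ b`, with
coefficient matrix `F = (½ tr (R⁻¹ Dᵢ R⁻¹ Dⱼ))` (`score_eq`). By Isserlis' formula the fluctuations
have covariance matrix `C` with `C_{(ab),(cd)} = R_{ac} R_{bd} + R_{ad} R_{bc}`, and `F C = 1`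
(`fisherTrace_mul_productCov`). Thus the Fisher information is `F C Fᵀ = F`, with inverse `C`. Both
estimators are linear functions of `S`, an average of independent matrices `z zᵀ` whose entries have
covariance `C`, so the central limit theorem in every direction yields the limit law
`N(0, J C Jᵀ) = N(0, J I⁻¹ Jᵀ)` (`isAsymptoticallyEfficient_of_isLinearMap`).
-/

namespace MultiCoset

open Matrix

/-! ### Maximum likelihood estimation of a Gaussian covariance matrix -/

section MLE
variable {q : ℕ}

open scoped MatrixOrder in
theorem exists_symm_sqrt {ι : Type*} [Fintype ι] [DecidableEq ι] {S : Matrix ι ι ℝ}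
    (hS : S.PosSemidef) :
    ∃ B : Matrix ι ι ℝ, Bᵀ = B ∧ B * B = S := by
  refine ⟨CFC.sqrt S, ?_, CFC.sqrt_mul_sqrt_self S hS.nonneg⟩
  have h : (CFC.sqrt S)ᴴ = CFC.sqrt S := (CFC.sqrt_nonneg S).isSelfAdjoint
  rwa [conjTranspose_eq_transpose_of_trivial] at h

/-- Sum of `1 + log λ ≤ λ` over the eigenvalues `λ` of `A`. -/
theorem PosDef.card_add_log_det_le_trace {A : Matrix (Fin q) (Fin q) ℝ} (hA : A.PosDef) :
    q + Real.log A.det ≤ A.trace := by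
  have h1 : A.det = ∏ i, hA.1.eigenvalues i := by
    simpa using hA.1.det_eq_prod_eigenvalues
  have h2 : A.trace = ∑ i, hA.1.eigenvalues i := by
    simpa using hA.1.trace_eq_sum_eigenvalues
  rw [h1, h2, Real.log_prod (fun i _ => (hA.eigenvalues_pos i).ne')]
  have : (q : ℝ) = ∑ _i : Fin q, (1 : ℝ) := by simp
  rw [this, ← Finset.sum_add_distrib]
  refine Finset.sum_le_sum fun i _ => ?_
  have := Real.log_le_sub_one_of_pos (hA.eigenvalues_pos i)
  linarith

/-- The equality case of `PosDef.card_add_log_det_le_trace`: every eigenvalue is `1`. -/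
theorem PosDef.eq_one_of_trace_le {A : Matrix (Fin q) (Fin q) ℝ} (hA : A.PosDef)
    (h : A.trace ≤ q + Real.log A.det) : A = 1 := by
  have h1 : A.det = ∏ i, hA.1.eigenvalues i := by
    simpa using hA.1.det_eq_prod_eigenvalues
  have h2 : A.trace = ∑ i, hA.1.eigenvalues i := by
    simpa using hA.1.trace_eq_sum_eigenvalues
  rw [h1, h2, Real.log_prod (fun i _ => (hA.eigenvalues_pos i).ne')] at h
  have hq : (q : ℝ) = ∑ _i : Fin q, (1 : ℝ) := by simp
  rw [hq, ← Finset.sum_add_distrib] at h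
  have hle : ∀ i ∈ Finset.univ, 1 + Real.log (hA.1.eigenvalues i) ≤ hA.1.eigenvalues i := by
    intro i _
    have := Real.log_le_sub_one_of_pos (hA.eigenvalues_pos i)
    linarith
  have heq := (Finset.sum_eq_sum_iff_of_le hle).1 (le_antisymm (Finset.sum_le_sum hle) h)
  have hone : hA.1.eigenvalues = fun _ => 1 := by
    funext i
    by_contra hne
    have := Real.log_lt_sub_one_of_pos (hA.eigenvalues_pos i) hne
    have := heq i (Finset.mem_univ i)
    linarith
  have hs := hA.1.spectral_theorem
  rw [hone] at hs
  have hd : diagonal ((RCLike.ofReal : ℝ → ℝ) ∘ fun _ : Fin q => (1 : ℝ)) = 1 := by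
    ext i j; simp [diagonal, one_apply]
  rw [hd, map_one] at hs
  exact hs

/-- The conjugate `B R⁻¹ Bᵀ` of `R⁻¹` by a square root `S = Bᵀ B` of `S` reduces the comparison of
`R` with `S` to a comparison with the identity matrix. -/
theorem exists_conj_posDef {R S : Matrix (Fin q) (Fin q) ℝ} (hR : R.PosDef) (hS : S.PosDef) :
    ∃ A : Matrix (Fin q) (Fin q) ℝ, A.PosDef ∧ A.trace = (R⁻¹ * S).trace ∧
      Real.log A.det = Real.log S.det - Real.log R.det ∧ (A = 1 → R = S) := by
  obtain ⟨B, hBsymm, hBB⟩ := exists_symm_sqrt hS.posSemidef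
  have hB : S = Bᵀ * B := by rw [hBsymm, hBB]
  have hSdet : S.det = B.det * B.det := by rw [hB, det_mul, det_transpose]
  have hBdet : B.det ≠ 0 := by
    intro h0
    have := hS.det_pos
    rw [hSdet, h0] at this
    simp at this
  have hBu : IsUnit B.det := hBdet.isUnit
  have hRu : IsUnit R.det := hR.det_pos.ne'.isUnit
  refine ⟨B * R⁻¹ * Bᵀ, ?_, ?_, ?_, ?_⟩
  · have := hR.inv.mul_mul_conjTranspose_same (B := B)
      (vecMul_injective_of_isUnit ((isUnit_iff_isUnit_det _).2 hBu))
    simpa using this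
  · rw [trace_mul_comm, ← Matrix.mul_assoc, ← hB, trace_mul_comm]
  · have : (B * R⁻¹ * Bᵀ).det = S.det / R.det := by
      rw [det_mul, det_mul, det_transpose, det_nonsing_inv, Ring.inverse_eq_inv', hSdet]
      field_simp
    rw [this, Real.log_div hS.det_pos.ne' hR.det_pos.ne']
  · intro h
    have hTu : IsUnit (Bᵀ).det := by rwa [det_transpose]
    have h1 : B * R⁻¹ = (Bᵀ)⁻¹ := by
      rw [← mul_nonsing_inv_cancel_right _ (B * R⁻¹) hTu, h, Matrix.one_mul]
    have h2 : Bᵀ * B * R⁻¹ = 1 := by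
      rw [Matrix.mul_assoc, h1, mul_nonsing_inv _ hTu]
    rw [← hB] at h2
    rw [← Matrix.mul_one S, ← nonsing_inv_mul R hRu, ← Matrix.mul_assoc, h2, Matrix.one_mul]

theorem log_gaussDensity {R : Matrix (Fin q) (Fin q) ℝ} (hR : 0 < R.det) (z : Fin q → ℝ) :
    Real.log (gaussDensity R z) =
      -(q * Real.log (2 * Real.pi) + Real.log R.det + z ⬝ᵥ R⁻¹.mulVec z) / 2 := by
  have hpi : 0 < (2 * Real.pi) ^ q := by positivity
  rw [gaussDensity, Real.log_mul (by positivity) (Real.exp_pos _).ne', Real.log_exp, Real.log_inv,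
    Real.log_sqrt (by positivity), Real.log_mul hpi.ne' hR.ne', Real.log_pow]
  ring

theorem trace_mul_vecMulVec (A : Matrix (Fin q) (Fin q) ℝ) (z : Fin q → ℝ) :
    (A * vecMulVec z z).trace = z ⬝ᵥ A.mulVec z := by
  rw [mul_vecMulVec, trace_vecMulVec, dotProduct_comm]

theorem logLik_eq {N : ℕ} (hN : N ≠ 0) (d : ℕ → Fin q → ℝ) {R : Matrix (Fin q) (Fin q) ℝ}
    (hR : R.PosDef) :
    logLik N d R = -(N / 2) * (q * Real.log (2 * Real.pi) + (Real.log R.det +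
      (R⁻¹ * ((N : ℝ)⁻¹ • ∑ n ∈ Finset.range N, vecMulVec (d n) (d n))).trace)) := by
  have hN' : (N : ℝ) ≠ 0 := by exact_mod_cast hN
  rw [logLik, Finset.sum_congr rfl fun n _ => log_gaussDensity hR.det_pos (d n), Matrix.mul_smul,
    trace_smul, Matrix.mul_sum, trace_sum, Finset.sum_congr rfl fun n _ => trace_mul_vecMulVec _ _,
    ← Finset.sum_div, Finset.sum_neg_distrib, Finset.sum_add_distrib, Finset.sum_const,
    Finset.card_range, nsmul_eq_mul, smul_eq_mul]
  field_simp
  ring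

/-- If the sample correlation matrix is positive definite, it is a maximum likelihood estimate
of the covariance matrix, and the only one. -/
theorem isMLE_iff_eq {N : ℕ} (hN : N ≠ 0) (d : ℕ → Fin q → ℝ)
    (hS : ((N : ℝ)⁻¹ • ∑ n ∈ Finset.range N, vecMulVec (d n) (d n)).PosDef)
    (R : Matrix (Fin q) (Fin q) ℝ) :
    IsMLE (logLik N d) R ↔ R = (N : ℝ)⁻¹ • ∑ n ∈ Finset.range N, vecMulVec (d n) (d n) := by
  have hN' : (0 : ℝ) < N := by exact_mod_cast Nat.pos_of_ne_zero hN
  have hl := fun {R : Matrix (Fin q) (Fin q) ℝ} (hR : R.PosDef) => logLik_eq hN d hR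
  set S := (N : ℝ)⁻¹ • ∑ n ∈ Finset.range N, vecMulVec (d n) (d n)
  have hSS : (S⁻¹ * S).trace = q := by
    rw [nonsing_inv_mul _ hS.det_pos.ne'.isUnit]; simp
  constructor
  · rintro ⟨hR, hmax⟩
    obtain ⟨A, hA, htr, hdet, hone⟩ := exists_conj_posDef hR hS
    refine hone (PosDef.eq_one_of_trace_le hA ?_)
    have := hmax S hS
    rw [hl hR, hl hS, hSS, neg_mul, neg_mul, neg_le_neg_iff, mul_le_mul_iff_right₀ (by positivity)]
      at this
    rw [htr, hdet]
    linarith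
  · rintro rfl
    refine ⟨hS, fun R hR => ?_⟩
    obtain ⟨A, hA, htr, hdet, -⟩ := exists_conj_posDef hR hS
    have := PosDef.card_add_log_det_le_trace hA
    rw [htr, hdet] at this
    rw [hl hR, hl hS, hSS, neg_mul, neg_mul, neg_le_neg_iff, mul_le_mul_iff_right₀ (by positivity)]
    linarith

/-- Invariance of maximum likelihood estimation: the value of a function at a maximum likelihood
estimate maximizes the induced likelihood. -/
theorem IsMLE.isMLEOf {β : Type*} {ℓ : Matrix (Fin q) (Fin q) ℝ → ℝ}
    {R' : Matrix (Fin q) (Fin q) ℝ} (h : IsMLE ℓ R') (g : Matrix (Fin q) (Fin q) ℝ → β) :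
    IsMLEOf ℓ g (g R') := by
  refine ⟨⟨R', h.1, rfl⟩, fun η => ?_⟩
  refine (iSup_le fun R : {R : Matrix (Fin q) (Fin q) ℝ // R.PosDef ∧ g R = η} =>
    EReal.coe_le_coe_iff.2 (h.2 R.1 R.2.1)).trans ?_
  exact le_iSup (fun R : {R : Matrix (Fin q) (Fin q) ℝ // R.PosDef ∧ g R = g R'} =>
    ((ℓ R.1 : ℝ) : EReal)) ⟨R', h.1, rfl⟩

end MLE

/-! ### The centred Gaussian law on `ℝ^q` -/

section GaussLaw
variable {q : ℕ}

theorem continuous_gaussDensity (R : Matrix (Fin q) (Fin q) ℝ) : Continuous (gaussDensity R) := by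
  unfold gaussDensity
  fun_prop

theorem gaussDensity_one (x : Fin q → ℝ) :
    gaussDensity 1 x = ∏ i, gaussianPDFReal 0 1 (x i) := by
  have h : ∀ i, gaussianPDFReal 0 1 (x i) =
      (Real.sqrt (2 * Real.pi))⁻¹ * Real.exp (-(x i * x i) / 2) := by
    intro i
    simp [gaussianPDFReal, sq]
  rw [Finset.prod_congr rfl fun i _ => h i, Finset.prod_mul_distrib, ← Real.exp_sum, gaussDensity]
  simp only [det_one, mul_one, inv_one, one_mulVec, Finset.prod_const, Finset.card_univ,
    Fintype.card_fin, dotProduct, ← Finset.sum_div, Finset.sum_neg_distrib]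
  rw [inv_pow, Real.sqrt_eq_rpow, Real.sqrt_eq_rpow, ← Real.rpow_natCast, ← Real.rpow_natCast,
    ← Real.rpow_mul (by positivity), ← Real.rpow_mul (by positivity), mul_comm (q : ℝ)]

theorem pi_gaussianReal_eq_gaussLaw_one :
    Measure.pi (fun _ : Fin q => gaussianReal 0 1) = gaussLaw 1 := by
  refine Measure.pi_eq fun s hs => ?_
  have hint : ∀ i, Integrable ((s i).indicator (gaussianPDFReal 0 1)) :=
    fun i => (integrable_gaussianPDFReal 0 1).indicator (hs i)
  have hnn : ∀ i x, 0 ≤ (s i).indicator (gaussianPDFReal 0 1) x :=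
    fun i x => Set.indicator_nonneg (fun y _ => gaussianPDFReal_nonneg 0 1 y) x
  have hprod : ∀ x : Fin q → ℝ, (Set.univ.pi s).indicator
      (fun z => ENNReal.ofReal (gaussDensity 1 z)) x =
        ENNReal.ofReal (∏ i, (s i).indicator (gaussianPDFReal 0 1) (x i)) := by
    intro x
    by_cases hx : x ∈ Set.univ.pi s
    · rw [Set.indicator_of_mem hx, gaussDensity_one]
      congr 1
      refine Finset.prod_congr rfl fun i _ => ?_
      rw [Set.indicator_of_mem (hx i (Set.mem_univ i))]
    · rw [Set.indicator_of_notMem hx]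
      simp only [Set.mem_pi, Set.mem_univ, true_imp_iff, not_forall] at hx
      obtain ⟨i, hi⟩ := hx
      rw [Finset.prod_eq_zero (Finset.mem_univ i) (Set.indicator_of_notMem hi _)]
      simp
  rw [gaussLaw, withDensity_apply _ (MeasurableSet.univ_pi hs),
    ← lintegral_indicator (MeasurableSet.univ_pi hs), lintegral_congr hprod,
    ← ofReal_integral_eq_lintegral_ofReal (by
        rw [volume_pi]; exact Integrable.fintype_prod hint)
      (ae_of_all _ fun x => Finset.prod_nonneg fun i _ => hnn i _),
    integral_fintype_prod_volume_eq_prod,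
    ENNReal.ofReal_prod_of_nonneg fun i _ => integral_nonneg (hnn i)]
  refine Finset.prod_congr rfl fun i _ => ?_
  rw [ofReal_integral_eq_lintegral_ofReal (hint i) (ae_of_all _ (hnn i)),
    gaussianReal_of_var_ne_zero _ one_ne_zero, withDensity_apply _ (hs i),
    ← lintegral_indicator (hs i)]
  refine lintegral_congr fun x => ?_
  by_cases hx : x ∈ s i <;> simp [hx, gaussianPDF]

theorem gaussDensity_mulVec {R B : Matrix (Fin q) (Fin q) ℝ} (hB : Bᵀ = B) (hBB : B * B = R)
    (hdet : B.det ≠ 0) (x : Fin q → ℝ) :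
    gaussDensity R (B.mulVec x) = |B.det|⁻¹ * gaussDensity 1 x := by
  have hu : IsUnit B.det := hdet.isUnit
  have h1 : R.det = B.det ^ 2 := by rw [← hBB, det_mul, sq]
  have h2 : B.mulVec x ⬝ᵥ R⁻¹.mulVec (B.mulVec x) = x ⬝ᵥ x := by
    have h3 : R⁻¹.mulVec (B.mulVec x) = B⁻¹.mulVec x := by
      rw [mulVec_mulVec, ← hBB, Matrix.mul_inv_rev, nonsing_inv_mul_cancel_right _ _ hu]
    have h4 : B.mulVec x = Matrix.vecMul x B := by rw [← mulVec_transpose, hB]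
    rw [h3, h4, ← dotProduct_mulVec, mulVec_mulVec, mul_nonsing_inv _ hu, one_mulVec]
  rw [gaussDensity, gaussDensity, h2, h1, det_one, mul_one, inv_one, one_mulVec,
    Real.sqrt_mul (by positivity), Real.sqrt_sq_eq_abs, mul_inv]
  ring

/-- The law with the Gaussian density of covariance matrix `R` is the image of the standard
Gaussian law under a square root of `R`, hence Mathlib's multivariate Gaussian measure. -/
theorem gaussLaw_eq_map {R : Matrix (Fin q) (Fin q) ℝ} (hR : R.PosDef) :
    gaussLaw R = (multivariateGaussian 0 R).map (WithLp.ofLp : EuclideanSpace ℝ (Fin q) → _) := by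
  obtain ⟨B, hB, hBB, hBdef⟩ : ∃ B : Matrix (Fin q) (Fin q) ℝ, Bᵀ = B ∧ B * B = R ∧
      multivariateGaussian 0 R = (stdGaussian (EuclideanSpace ℝ (Fin q))).map
        (fun x => 0 + toEuclideanCLM (𝕜 := ℝ) B x) := by
    open scoped MatrixOrder in
    have h : (CFC.sqrt R)ᴴ = CFC.sqrt R := (CFC.sqrt_nonneg R).isSelfAdjoint
    rw [conjTranspose_eq_transpose_of_trivial] at h
    exact ⟨CFC.sqrt R, h, CFC.sqrt_mul_sqrt_self R hR.posSemidef.nonneg, rfl⟩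
  have hdet : B.det ≠ 0 := by
    intro h0
    have := hR.det_pos
    rw [← hBB, det_mul, h0] at this
    simp at this
  rw [hBdef, ← map_pi_eq_stdGaussian, Measure.map_map (by fun_prop) (by fun_prop),
    Measure.map_map (by fun_prop) (by fun_prop), pi_gaussianReal_eq_gaussLaw_one]
  have hfun : ((WithLp.ofLp : EuclideanSpace ℝ (Fin q) → _) ∘
      fun x => 0 + toEuclideanCLM (𝕜 := ℝ) B x) ∘ WithLp.toLp 2 = toLin' B := by
    funext x
    simp
  rw [hfun]
  have hmB : Measurable (toLin' B) := by
    have : Continuous (toLin' B) := LinearMap.continuous_of_finiteDimensional _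
    exact this.measurable
  have hmeas : ∀ R : Matrix (Fin q) (Fin q) ℝ,
      Measurable fun z => ENNReal.ofReal (gaussDensity R z) :=
    fun R => ENNReal.measurable_ofReal.comp (continuous_gaussDensity R).measurable
  ext s hs
  rw [Measure.map_apply hmB hs, gaussLaw, gaussLaw, withDensity_apply _ hs,
    withDensity_apply _ (hmB hs)]
  have hvol : (volume : Measure (Fin q → ℝ)) =
      ENNReal.ofReal |B.det| • Measure.map (toLin' B) volume := by
    rw [Real.map_matrix_volume_pi_eq_smul_volume_pi hdet, smul_smul, ← ENNReal.ofReal_mul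
      (abs_nonneg _), abs_inv, mul_inv_cancel₀ (abs_ne_zero.2 hdet)]
    simp
  conv_lhs => rw [hvol]
  rw [Measure.restrict_smul, lintegral_smul_measure, setLIntegral_map hs (hmeas R) hmB, smul_eq_mul,
    ← lintegral_const_mul _ (by exact (hmeas R).comp hmB)]
  refine lintegral_congr fun x => ?_
  rw [← ENNReal.ofReal_mul (abs_nonneg _), toLin'_apply, gaussDensity_mulVec hB hBB hdet,
    mul_inv_cancel_left₀ (abs_ne_zero.2 hdet)]

theorem isProbabilityMeasure_gaussLaw {R : Matrix (Fin q) (Fin q) ℝ} (hR : R.PosDef) :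
    IsProbabilityMeasure (gaussLaw R) := by
  rw [gaussLaw_eq_map hR]
  exact Measure.isProbabilityMeasure_map (by fun_prop)

/-- A law on `ℝ^q` whose linear functionals `v ⬝ᵥ z` are centred Gaussian with variance
`v ⬝ᵥ R v` is the Gaussian law of covariance matrix `R` (Cramér–Wold). -/
theorem eq_gaussLaw_of_map_dotProduct {R : Matrix (Fin q) (Fin q) ℝ} (hR : R.PosDef)
    {ν : Measure (Fin q → ℝ)} [IsProbabilityMeasure ν]
    (h : ∀ v : Fin q → ℝ, ν.map (fun z => v ⬝ᵥ z) = gaussianReal 0 (v ⬝ᵥ R.mulVec v).toNNReal) :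
    ν = gaussLaw R := by
  have key : ν.map (WithLp.toLp 2 : _ → EuclideanSpace ℝ (Fin q)) = multivariateGaussian 0 R := by
    have := Measure.isProbabilityMeasure_map (μ := ν)
      (f := (WithLp.toLp 2 : _ → EuclideanSpace ℝ (Fin q))) (by fun_prop)
    refine Measure.ext_of_charFun (funext fun t => ?_)
    have h1 := charFun_gaussianReal (μ := 0) (v := (t.ofLp ⬝ᵥ R.mulVec t.ofLp).toNNReal) 1
    have h0 : 0 ≤ t.ofLp ⬝ᵥ R.mulVec t.ofLp := by
      simpa using hR.posSemidef.dotProduct_mulVec_nonneg t.ofLp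
    rw [← h, charFun_apply_real, integral_map (by fun_prop) (by fun_prop)] at h1
    rw [charFun_multivariateGaussian hR.posSemidef, charFun_apply,
      integral_map (by fun_prop) (by fun_prop)]
    simp only [Complex.ofReal_one, one_mul, mul_zero, zero_mul, one_pow, mul_one, zero_sub,
      Complex.ofReal_zero, Real.coe_toNNReal _ h0, inner_zero_right] at h1 ⊢
    rw [← h1]
    simp [EuclideanSpace.inner_eq_star_dotProduct]
  rw [gaussLaw_eq_map hR, ← key, Measure.map_map (by fun_prop) (by fun_prop)]
  simp [Function.comp_def]

theorem gaussLaw_map_dotProduct {R : Matrix (Fin q) (Fin q) ℝ} (hR : R.PosDef) (v : Fin q → ℝ) :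
    (gaussLaw R).map (fun z => v ⬝ᵥ z) = gaussianReal 0 (v ⬝ᵥ R.mulVec v).toNNReal := by
  have h0 : 0 ≤ v ⬝ᵥ R.mulVec v := by
    simpa using hR.posSemidef.dotProduct_mulVec_nonneg v
  rw [gaussLaw_eq_map hR, Measure.map_map (by fun_prop) (by fun_prop)]
  have : IsProbabilityMeasure ((multivariateGaussian 0 R).map
    ((fun z => v ⬝ᵥ z) ∘ (WithLp.ofLp : EuclideanSpace ℝ (Fin q) → _))) :=
    Measure.isProbabilityMeasure_map (by fun_prop)
  refine Measure.ext_of_charFun (funext fun t => ?_)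
  have h1 := charFun_multivariateGaussian (μ := 0) hR.posSemidef (WithLp.toLp 2 (t • v))
  rw [charFun_gaussianReal, charFun_apply_real, integral_map (by fun_prop) (by fun_prop)]
  rw [charFun_apply] at h1
  have h2 : ∀ x : EuclideanSpace ℝ (Fin q), ((inner ℝ x (WithLp.toLp 2 (t • v)) : ℝ) : ℂ) =
      t * ((v ⬝ᵥ x.ofLp : ℝ) : ℂ) := by
    intro x
    simp [EuclideanSpace.inner_eq_star_dotProduct]
  simp only [h2] at h1
  simp only [Function.comp_def]
  rw [h1]
  simp only [mul_zero, zero_mul, zero_sub, Complex.ofReal_zero, Real.coe_toNNReal _ h0,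
    inner_zero_right, mulVec_smul, dotProduct_smul, smul_dotProduct, smul_eq_mul]
  push_cast
  ring_nf

end GaussLaw

/-! ### Second and fourth moments of Gaussian vectors -/

section Moments

/-- The fourth moment is the fourth derivative at `0` of the moment generating function. -/
theorem integral_pow_four_gaussianReal (v : NNReal) :
    ∫ x, x ^ 4 ∂(gaussianReal 0 v) = 3 * (v : ℝ) ^ 2 := by
  have h := iteratedDeriv_mgf_zero (X := id) (μ := gaussianReal 0 v)
    (by rw [integrableExpSet_id_gaussianReal]; simp) 4
  simp only [Pi.pow_apply, id_eq] at h
  rw [← h, mgf_id_gaussianReal]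
  have he : ∀ t : ℝ, HasDerivAt (fun t : ℝ => Real.exp (0 * t + v * t ^ 2 / 2))
      (v * t * Real.exp (0 * t + v * t ^ 2 / 2)) t := by
    intro t
    have h1 : HasDerivAt (fun t : ℝ => 0 * t + v * t ^ 2 / 2) (v * t) t := by
      have := (((hasDerivAt_id t).pow 2).const_mul (v : ℝ)).div_const 2
      have := ((hasDerivAt_id t).const_mul (0 : ℝ)).add this
      convert! this using 1
      simp
      ring
    convert! h1.exp using 1
    ring
  -- each derivative is a polynomial multiple of the moment generating function
  have hstep : ∀ (p p' : ℝ → ℝ), (∀ t, HasDerivAt p (p' t) t) →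
      deriv (fun t => p t * Real.exp (0 * t + v * t ^ 2 / 2)) =
        fun t => (p' t + p t * (v * t)) * Real.exp (0 * t + v * t ^ 2 / 2) := by
    intro p p' hp
    funext t
    refine HasDerivAt.deriv ?_
    convert! (hp t).mul (he t) using 1
    ring
  have hid : ∀ t : ℝ, HasDerivAt (fun t : ℝ => t) 1 t := fun t => hasDerivAt_id t
  have d1 : deriv (fun t : ℝ => Real.exp (0 * t + v * t ^ 2 / 2)) =
      fun t => (v * t) * Real.exp (0 * t + v * t ^ 2 / 2) := by
    funext t
    rw [(he t).deriv]
  have d2 := hstep (fun t => v * t) (fun t => v * 1) (fun t => (hid t).const_mul _)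
  have d3 := hstep (fun t => v * 1 + v * t * (v * t))
    (fun t => v * 1 * (v * t) + v * t * (v * 1))
    (fun t => (((hid t).const_mul (v : ℝ)).mul ((hid t).const_mul (v : ℝ))).const_add _)
  have d4 := hstep
    (fun t => v * 1 * (v * t) + v * t * (v * 1) + (v * 1 + v * t * (v * t)) * (v * t))
    (fun t => v * 1 * (v * 1) + v * 1 * (v * 1) +
      ((v * 1 * (v * t) + v * t * (v * 1)) * (v * t) + (v * 1 + v * t * (v * t)) * (v * 1)))
    (fun t => ((((hid t).const_mul (v : ℝ)).const_mul ((v : ℝ) * 1)).add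
      (((hid t).const_mul (v : ℝ)).mul_const ((v : ℝ) * 1))).add
      (((((hid t).const_mul (v : ℝ)).mul ((hid t).const_mul (v : ℝ))).const_add _).mul
        ((hid t).const_mul (v : ℝ))))
  simp only [iteratedDeriv_succ, iteratedDeriv_zero]
  rw [d1, d2, d3, d4]
  simp
  ring

variable {q : ℕ} {R : Matrix (Fin q) (Fin q) ℝ}

theorem memLp_dotProduct_gaussLaw (hR : R.PosDef) (v : Fin q → ℝ) {p : ENNReal} (hp : p ≠ ⊤) :
    MemLp (fun z => v ⬝ᵥ z) p (gaussLaw R) := by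
  have h := memLp_id_gaussianReal' (μ := 0) (v := (v ⬝ᵥ R.mulVec v).toNNReal) p hp
  rw [← gaussLaw_map_dotProduct hR v] at h
  exact h.comp_of_map (by fun_prop)

theorem memLp_apply_gaussLaw (hR : R.PosDef) (a : Fin q) {p : ENNReal} (hp : p ≠ ⊤) :
    MemLp (fun z => z a) p (gaussLaw R) := by
  simpa using memLp_dotProduct_gaussLaw hR (Pi.single a 1) hp

theorem memLp_mul_gaussLaw (hR : R.PosDef) (a b : Fin q) :
    MemLp (fun z => z a * z b) 2 (gaussLaw R) := by
  have : ENNReal.HolderTriple 4 4 2 := ⟨by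
    rw [← two_mul, show (4 : ENNReal) = 2 * 2 by norm_num, ENNReal.mul_inv (by simp) (by simp),
      ← mul_assoc, ENNReal.mul_inv_cancel (by simp) (by simp), one_mul]⟩
  exact (memLp_apply_gaussLaw hR b (p := 4) (by simp)).mul
    (memLp_apply_gaussLaw hR a (p := 4) (by simp))

theorem integral_dotProduct_sq_gaussLaw (hR : R.PosDef) (v : Fin q → ℝ) :
    ∫ z, (v ⬝ᵥ z) ^ 2 ∂(gaussLaw R) = v ⬝ᵥ R.mulVec v := by
  have h0 : 0 ≤ v ⬝ᵥ R.mulVec v := by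
    simpa using hR.posSemidef.dotProduct_mulVec_nonneg v
  have h := variance_fun_id_gaussianReal (μ := 0) (v := (v ⬝ᵥ R.mulVec v).toNNReal)
  rw [variance_eq_integral (by fun_prop), integral_id_gaussianReal,
    ← gaussLaw_map_dotProduct hR v, integral_map (by fun_prop) (by fun_prop),
    Real.coe_toNNReal _ h0] at h
  simpa using h

theorem integral_dotProduct_pow_four_gaussLaw (hR : R.PosDef) (v : Fin q → ℝ) :
    ∫ z, (v ⬝ᵥ z) ^ 4 ∂(gaussLaw R) = 3 * (v ⬝ᵥ R.mulVec v) ^ 2 := by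
  have h0 : 0 ≤ v ⬝ᵥ R.mulVec v := by
    simpa using hR.posSemidef.dotProduct_mulVec_nonneg v
  have h := integral_pow_four_gaussianReal (v ⬝ᵥ R.mulVec v).toNNReal
  rwa [← gaussLaw_map_dotProduct hR v, integral_map (by fun_prop) (by fun_prop),
    Real.coe_toNNReal _ h0] at h

theorem integral_mul_gaussLaw (hR : R.PosDef) (a b : Fin q) :
    ∫ z, z a * z b ∂(gaussLaw R) = R a b := by
  have hs : R b a = R a b := by simpa using hR.isHermitian.apply a b
  have key : ∀ z : Fin q → ℝ, z a * z b =
      (((Pi.single a 1 + Pi.single b 1 : Fin q → ℝ) ⬝ᵥ z) ^ 2 -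
        ((Pi.single a 1 - Pi.single b 1 : Fin q → ℝ) ⬝ᵥ z) ^ 2) / 4 := by
    intro z
    simp only [add_dotProduct, sub_dotProduct, single_dotProduct, one_mul]
    ring
  have hi := fun v : Fin q → ℝ => (memLp_dotProduct_gaussLaw hR v (p := 2) (by simp)).integrable_sq
  simp_rw [key]
  rw [integral_div, integral_sub (hi _) (hi _), integral_dotProduct_sq_gaussLaw hR,
    integral_dotProduct_sq_gaussLaw hR]
  simp only [add_dotProduct, sub_dotProduct, single_dotProduct, one_mul, mulVec_add, mulVec_sub,
    dotProduct_add, dotProduct_sub, mulVec_single_one, col_apply, hs]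
  ring

/-- Isserlis' formula for fourth moments, obtained from `E (v ⬝ᵥ z)⁴ = 3 (v ⬝ᵥ R v)²` by
polarization over the eight vectors `e_a ± e_b ± e_c ± e_d`. -/
theorem integral_mul_mul_mul_gaussLaw (hR : R.PosDef) (a b c d : Fin q) :
    ∫ z, (z a * z b) * (z c * z d) ∂(gaussLaw R) =
      R a b * R c d + R a c * R b d + R a d * R b c := by
  have hs : ∀ i j, R i j = R j i := fun i j => by simpa using hR.isHermitian.apply j i
  let e : Fin q → Fin q → ℝ := fun a => Pi.single a 1
  let V : ℝ → ℝ → ℝ → Fin q → ℝ := fun s t u => e a + s • e b + t • e c + u • e d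
  have hV : ∀ s t u z, V s t u ⬝ᵥ z = z a + s * z b + t * z c + u * z d := by
    intro s t u z
    simp [V, e, add_dotProduct]
  have key : ∀ z : Fin q → ℝ, (z a * z b) * (z c * z d) =
      ((V 1 1 1 ⬝ᵥ z) ^ 4 - (V 1 1 (-1) ⬝ᵥ z) ^ 4 - (V 1 (-1) 1 ⬝ᵥ z) ^ 4 +
        (V 1 (-1) (-1) ⬝ᵥ z) ^ 4 - (V (-1) 1 1 ⬝ᵥ z) ^ 4 + (V (-1) 1 (-1) ⬝ᵥ z) ^ 4 +
        (V (-1) (-1) 1 ⬝ᵥ z) ^ 4 - (V (-1) (-1) (-1) ⬝ᵥ z) ^ 4) / 192 := by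
    intro z
    simp only [hV]
    ring
  have hi : ∀ v : Fin q → ℝ, Integrable (fun z => (v ⬝ᵥ z) ^ 4) (gaussLaw R) := by
    intro v
    have := (memLp_dotProduct_gaussLaw hR v (p := (4 : ℕ)) (by simp)).integrable_norm_pow
      (by norm_num)
    refine this.congr (ae_of_all _ fun z => ?_)
    simp only [Real.norm_eq_abs]
    exact Even.pow_abs (by decide) _
  have hQ : ∀ s t u, V s t u ⬝ᵥ R.mulVec (V s t u) =
      R a a + s ^ 2 * R b b + t ^ 2 * R c c + u ^ 2 * R d d + 2 * s * R a b + 2 * t * R a c +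
        2 * u * R a d + 2 * s * t * R b c + 2 * s * u * R b d + 2 * t * u * R c d := by
    intro s t u
    simp only [V, e, add_dotProduct, smul_dotProduct, single_dotProduct, one_mul, mulVec_add,
      mulVec_smul, Pi.add_apply, Pi.smul_apply, smul_eq_mul, mulVec_single_one, col_apply,
      hs b a, hs c a, hs c b, hs d a, hs d b, hs d c]
    ring
  simp_rw [key]
  rw [integral_div, integral_sub (by fun_prop) (hi _), integral_add (by fun_prop) (hi _),
    integral_add (by fun_prop) (hi _), integral_sub (by fun_prop) (hi _),
    integral_add (by fun_prop) (hi _), integral_sub (by fun_prop) (hi _),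
    integral_sub (hi _) (hi _)]
  simp only [integral_dotProduct_pow_four_gaussLaw hR, hQ]
  ring

end Moments

/-! ### Scores of the Gaussian model -/

section Fisher
variable {q : ℕ} {R : Matrix (Fin q) (Fin q) ℝ}

theorem symDir_apply (i : SymIdx q) (a b : Fin q) :
    symDir i a b = if i.1 = (a, b) ∨ i.1 = (b, a) then 1 else 0 := by
  obtain ⟨⟨m, n⟩, h⟩ := i
  simp only [symDir, Prod.mk.injEq]
  by_cases hmn : m = n
  · subst hmn
    by_cases ha : m = a <;> by_cases hb : m = b <;> simp_all
  · rw [if_neg hmn]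
    by_cases ha : m = a <;> by_cases hb : n = b <;> by_cases ha' : n = a <;>
      by_cases hb' : m = b <;> simp_all

theorem symDir_transpose (i : SymIdx q) : (symDir i)ᵀ = symDir i := by
  ext a b
  simp only [transpose_apply, symDir_apply]
  exact if_congr or_comm rfl rfl

theorem symDir_apply_free (i k : SymIdx q) :
    symDir i k.1.1 k.1.2 = (1 : Matrix (SymIdx q) (SymIdx q) ℝ) i k := by
  rw [symDir_apply, one_apply]
  obtain ⟨⟨m, n⟩, h⟩ := i
  obtain ⟨⟨m', n'⟩, h'⟩ := k
  refine if_congr ?_ rfl rfl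
  simp only [Prod.mk.injEq, Subtype.mk.injEq] at h h' ⊢
  constructor
  · rintro (h1 | ⟨rfl, rfl⟩)
    · exact h1
    · exact ⟨le_antisymm h h', le_antisymm h' h⟩
  · exact Or.inl

theorem sum_smul_symDir {Q : Matrix (Fin q) (Fin q) ℝ} (hQ : Qᵀ = Q) :
    ∑ i : SymIdx q, Q i.1.1 i.1.2 • symDir i = Q := by
  ext a b
  rw [Matrix.sum_apply]
  simp only [Matrix.smul_apply, symDir_apply, smul_eq_mul, mul_ite, mul_one, mul_zero]
  have hab : Q b a = Q a b := by conv_rhs => rw [← hQ, transpose_apply]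
  rcases le_total a b with h | h
  · rw [Finset.sum_eq_single (⟨(a, b), h⟩ : SymIdx q)]
    · simp
    · rintro ⟨⟨m, n⟩, hmn⟩ - hne
      rw [if_neg]
      simp only [ne_eq, Subtype.mk.injEq, Prod.mk.injEq] at hne hmn ⊢
      rintro (h1 | ⟨rfl, rfl⟩)
      · exact hne h1
      · exact hne ⟨le_antisymm hmn h, le_antisymm h hmn⟩
    · simp
  · rw [Finset.sum_eq_single (⟨(b, a), h⟩ : SymIdx q)]
    · simp [hab]
    · rintro ⟨⟨m, n⟩, hmn⟩ - hne
      rw [if_neg]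
      simp only [ne_eq, Subtype.mk.injEq, Prod.mk.injEq] at hne hmn ⊢
      rintro (⟨rfl, rfl⟩ | h1)
      · exact hne ⟨le_antisymm hmn h, le_antisymm h hmn⟩
      · exact hne h1
    · simp

/-- Jacobi's formula for the derivative of the determinant. -/
theorem hasDerivAt_det_add_smul (hR : IsUnit R.det) (D : Matrix (Fin q) (Fin q) ℝ) :
    HasDerivAt (fun t : ℝ => (R + t • D).det) (R.det * (R⁻¹ * D).trace) 0 := by
  have h : ∀ t : ℝ, (R + t • D).det = R.det * (1 + t • (R⁻¹ * D)).det := by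
    intro t
    rw [← det_mul, Matrix.mul_add, Matrix.mul_one, Matrix.mul_smul, ← Matrix.mul_assoc,
      mul_nonsing_inv _ hR, Matrix.one_mul]
  simp_rw [h]
  refine HasDerivAt.const_mul _ ?_
  rw [funext fun t => det_one_add_smul t (R⁻¹ * D)]
  set p := (det (1 + (Polynomial.X : Polynomial ℝ) •
    (R⁻¹ * D).map Polynomial.C)).divX.divX
  have h1 := ((hasDerivAt_id (0 : ℝ)).const_mul (R⁻¹ * D).trace).const_add 1
  have h2 := (p.hasDerivAt (0 : ℝ)).mul ((hasDerivAt_id (0 : ℝ)).pow 2)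
  convert! h1.add h2 using 1
  simp

theorem hasDerivAt_dotProduct_inv_mulVec (hR : IsUnit R.det) (D : Matrix (Fin q) (Fin q) ℝ)
    (z : Fin q → ℝ) :
    HasDerivAt (fun t : ℝ => z ⬝ᵥ (R + t • D)⁻¹.mulVec z)
      (-(z ⬝ᵥ (R⁻¹ * D * R⁻¹).mulVec z)) 0 := by
  have hcdet : Continuous fun t : ℝ => (R + t • D).det := by fun_prop
  have hne : ∀ᶠ t in 𝓝 (0 : ℝ), (R + t • D).det ≠ 0 :=
    hcdet.continuousAt.eventually_ne (by simpa using hR.ne_zero)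
  let h : ℝ → ℝ := fun t => z ⬝ᵥ ((R + t • D)⁻¹ * D * R⁻¹).mulVec z
  have hc : ContinuousAt h 0 := by
    have h1 : h = fun t => ((R + t • D).det)⁻¹ *
        (z ⬝ᵥ ((R + t • D).adjugate * D * R⁻¹).mulVec z) := by
      funext t
      simp only [h, inv_def, Ring.inverse_eq_inv', Matrix.smul_mul, smul_mulVec, dotProduct_smul,
        smul_eq_mul]
    rw [h1]
    refine ContinuousAt.mul ?_ ?_
    · exact hcdet.continuousAt.inv₀ (by simpa using hR.ne_zero)
    · exact Continuous.continuousAt (by fun_prop)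
  -- `(R + tD)⁻¹ = R⁻¹ - t (R + tD)⁻¹ D R⁻¹`
  have hev : (fun t : ℝ => z ⬝ᵥ (R + t • D)⁻¹.mulVec z) =ᶠ[𝓝 0]
      fun t => z ⬝ᵥ R⁻¹.mulVec z - t * h t := by
    filter_upwards [hne] with t ht
    have e : (R + t • D)⁻¹ = R⁻¹ - t • ((R + t • D)⁻¹ * D * R⁻¹) := by
      have e1 : (R + t • D)⁻¹ * (R + t • D) * R⁻¹ = R⁻¹ := by
        rw [nonsing_inv_mul _ ht.isUnit, Matrix.one_mul]
      rw [Matrix.mul_add, Matrix.add_mul, Matrix.mul_assoc _ R, mul_nonsing_inv _ hR,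
        Matrix.mul_one, Matrix.mul_smul, Matrix.smul_mul] at e1
      exact eq_sub_of_add_eq e1
    conv_lhs => rw [e]
    rw [sub_mulVec, dotProduct_sub, smul_mulVec, dotProduct_smul, smul_eq_mul]
  have h0 : h 0 = z ⬝ᵥ (R⁻¹ * D * R⁻¹).mulVec z := by simp [h]
  rw [← h0]
  refine HasDerivAt.congr_of_eventuallyEq ?_ hev
  have h2 : HasDerivAt (fun t => t * h t) (h 0) 0 := by
    rw [hasDerivAt_iff_tendsto_slope_zero]
    refine (hc.tendsto.mono_left nhdsWithin_le_nhds).congr' ?_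
    filter_upwards [self_mem_nhdsWithin] with t ht
    simp [inv_mul_cancel_left₀ (show t ≠ 0 from ht)]
  exact h2.const_sub _

/-- Fisher information `½ tr (R⁻¹ Dᵢ R⁻¹ Dⱼ)` of the centred Gaussian model. -/
noncomputable def fisherTrace (R : Matrix (Fin q) (Fin q) ℝ) : Matrix (SymIdx q) (SymIdx q) ℝ :=
  Matrix.of fun i j => (R⁻¹ * symDir i * R⁻¹ * symDir j).trace / 2

/-- Covariances of the products `z a * z b`, `a ≤ b`, for a centred Gaussian vector `z` of
covariance matrix `R`. -/
noncomputable def productCov (R : Matrix (Fin q) (Fin q) ℝ) : Matrix (SymIdx q) (SymIdx q) ℝ :=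
  Matrix.of fun i j => R i.1.1 j.1.1 * R i.1.2 j.1.2 + R i.1.1 j.1.2 * R i.1.2 j.1.1

/-- The score in the direction `D = symDir i` is `½ tr (R⁻¹ D R⁻¹ (z zᵀ - R))`; here `z zᵀ - R` is
expanded in the basis `symDir` of the symmetric matrices. -/
theorem score_eq (hR : R.PosDef) (i : SymIdx q) (z : Fin q → ℝ) :
    score R i z = ∑ j, fisherTrace R i j * (z j.1.1 * z j.1.2 - R j.1.1 j.1.2) := by
  have hu : IsUnit R.det := hR.det_pos.ne'.isUnit
  have hsymm : Rᵀ = R := by simpa using hR.isHermitian.eq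
  set D := symDir i with hD
  have h1 : score R i z = -((R⁻¹ * D).trace - z ⬝ᵥ (R⁻¹ * D * R⁻¹).mulVec z) / 2 := by
    have hcdet : Continuous fun t : ℝ => (R + t • D).det := by fun_prop
    have hpos : ∀ᶠ t in 𝓝 (0 : ℝ), 0 < (R + t • D).det :=
      hcdet.continuousAt.eventually (lt_mem_nhds (by simpa using hR.det_pos))
    have hev : (fun t : ℝ => Real.log (gaussDensity (R + t • D) z)) =ᶠ[𝓝 0] fun t : ℝ =>
        -(q * Real.log (2 * Real.pi) + Real.log (R + t • D).det +
          z ⬝ᵥ (R + t • D)⁻¹.mulVec z) / 2 := by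
      filter_upwards [hpos] with t ht using log_gaussDensity ht z
    rw [score, ← hD, hev.deriv_eq]
    have hl := (hasDerivAt_det_add_smul hu D).log (by simpa using hR.det_pos.ne')
    have := (((hl.const_add (q * Real.log (2 * Real.pi))).add
      (hasDerivAt_dotProduct_inv_mulVec hu D z)).neg.div_const 2).deriv
    refine Eq.trans this ?_
    simp only [zero_smul, add_zero]
    rw [mul_div_cancel_left₀ _ hR.det_pos.ne']
    ring
  have h2 : (R⁻¹ * D).trace = (R⁻¹ * D * R⁻¹ * R).trace := by
    rw [nonsing_inv_mul_cancel_right _ _ hu]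
  rw [h1, h2, ← trace_mul_vecMulVec]
  have hQ : (vecMulVec z z - R)ᵀ = vecMulVec z z - R := by
    rw [transpose_sub, transpose_vecMulVec, hsymm]
  have h3 := congrArg (fun Q => (R⁻¹ * D * R⁻¹ * Q).trace / 2) (sum_smul_symDir hQ)
  simp only [Matrix.mul_sum, trace_sum, Matrix.mul_smul, trace_smul, smul_eq_mul, Finset.sum_div,
    Matrix.mul_sub, trace_sub] at h3
  rw [neg_sub, ← h3]
  refine Finset.sum_congr rfl fun j _ => ?_
  rw [fisherTrace, of_apply, Matrix.sub_apply, vecMulVec_apply]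
  ring

/-- Each column of `productCov R` lists the entries of a matrix `R E R`, so pairing it with
`R⁻¹ Dᵢ R⁻¹` cancels `R`. -/
theorem fisherTrace_mul_productCov (hR : R.PosDef) : fisherTrace R * productCov R = 1 := by
  have hu : IsUnit R.det := hR.det_pos.ne'.isUnit
  have hsymm : ∀ a b, R a b = R b a := fun a b => by simpa using hR.isHermitian.apply b a
  ext i k
  set E : Matrix (Fin q) (Fin q) ℝ := single k.1.1 k.1.2 1 + single k.1.2 k.1.1 1
  have hE : ∀ a b, (R * E * R) a b = R a k.1.1 * R b k.1.2 + R a k.1.2 * R b k.1.1 := by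
    intro a b
    simp [E, Matrix.mul_add, mul_apply, single_apply, ite_and, _root_.add_mul,
      Finset.sum_add_distrib, hsymm b]
  have hEt : (R * E * R)ᵀ = R * E * R := by
    ext a b
    rw [transpose_apply, hE, hE]
    ring
  have h1 : (fisherTrace R * productCov R) i k =
      (R⁻¹ * symDir i * R⁻¹ * (R * E * R)).trace / 2 := by
    rw [← sum_smul_symDir hEt, mul_apply, Matrix.mul_sum, trace_sum, Finset.sum_div]
    refine Finset.sum_congr rfl fun j _ => ?_
    rw [Matrix.mul_smul, trace_smul, hE, fisherTrace, productCov, of_apply, of_apply, smul_eq_mul]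
    ring
  have h2 : (R⁻¹ * symDir i * R⁻¹ * (R * E * R)).trace = (symDir i * E).trace := by
    rw [trace_mul_comm, Matrix.mul_assoc _ R, Matrix.mul_assoc R⁻¹, ← Matrix.mul_assoc R R⁻¹,
      mul_nonsing_inv _ hu, Matrix.one_mul, Matrix.mul_assoc R, trace_mul_comm R,
      Matrix.mul_assoc, Matrix.mul_assoc, nonsing_inv_mul _ hu, Matrix.mul_one, trace_mul_comm]
  have h3 : symDir i k.1.2 k.1.1 = symDir i k.1.1 k.1.2 := by
    conv_lhs => rw [← symDir_transpose, transpose_apply]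
  rw [h1, h2, Matrix.mul_add, trace_add, trace_mul_single, trace_mul_single, h3,
    MulOpposite.op_one, one_smul, symDir_apply_free]
  ring

end Fisher

/-! ### Fisher information and asymptotic efficiency -/

section Efficiency
variable {q : ℕ} {R : Matrix (Fin q) (Fin q) ℝ}

/-- The quadratic form of a Gram matrix in `L²` is the squared norm of the linear combination. -/
theorem dotProduct_gram_mulVec {α κ : Type*} [Fintype κ] [MeasurableSpace α] {ν : Measure α}
    {f : κ → α → ℝ} (hf : ∀ i, MemLp (f i) 2 ν) (y : κ → ℝ) :
    y ⬝ᵥ (Matrix.of fun i j => ∫ a, f i a * f j a ∂ν).mulVec y =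
      ∫ a, (∑ i, y i * f i a) ^ 2 ∂ν := by
  have hij : ∀ i j, Integrable (fun a => f i a * f j a) ν := fun i j => (hf i).integrable_mul (hf j)
  have h : ∀ a, (∑ i, y i * f i a) ^ 2 = ∑ i, ∑ j, y i * (y j * (f i a * f j a)) := by
    intro a
    rw [sq, Finset.sum_mul_sum]
    refine Finset.sum_congr rfl fun i _ => Finset.sum_congr rfl fun j _ => by ring
  simp_rw [h]
  rw [integral_finsetSum _ fun i _ => integrable_finsetSum _ fun j _ =>
    ((hij i j).const_mul _).const_mul _]
  refine Finset.sum_congr rfl fun i _ => ?_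
  rw [integral_finsetSum _ fun j _ => ((hij i j).const_mul _).const_mul _, mulVec, dotProduct,
    Finset.mul_sum]
  refine Finset.sum_congr rfl fun j _ => ?_
  rw [integral_const_mul, integral_const_mul, of_apply]
  ring

theorem memLp_productFluct (hR : R.PosDef) (i : SymIdx q) :
    MemLp (fun z : Fin q → ℝ => z i.1.1 * z i.1.2 - R i.1.1 i.1.2) 2 (gaussLaw R) := by
  have := isProbabilityMeasure_gaussLaw hR
  exact (memLp_mul_gaussLaw hR _ _).sub (memLp_const _)

/-- By Isserlis' formula, `productCov R` is the covariance matrix of the products. -/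
theorem productCov_eq_gram (hR : R.PosDef) :
    productCov R = Matrix.of fun i j : SymIdx q => ∫ z, (z i.1.1 * z i.1.2 - R i.1.1 i.1.2) *
      (z j.1.1 * z j.1.2 - R j.1.1 j.1.2) ∂(gaussLaw R) := by
  have := isProbabilityMeasure_gaussLaw hR
  ext i j
  have hi := fun a b => (memLp_mul_gaussLaw hR a b).integrable (by norm_num)
  have hij := (memLp_mul_gaussLaw hR i.1.1 i.1.2).integrable_mul
    (memLp_mul_gaussLaw hR j.1.1 j.1.2)
  have h : ∀ z : Fin q → ℝ, (z i.1.1 * z i.1.2 - R i.1.1 i.1.2) *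
      (z j.1.1 * z j.1.2 - R j.1.1 j.1.2) = (z i.1.1 * z i.1.2) * (z j.1.1 * z j.1.2) -
      R j.1.1 j.1.2 * (z i.1.1 * z i.1.2) - R i.1.1 i.1.2 * (z j.1.1 * z j.1.2) +
      R i.1.1 i.1.2 * R j.1.1 j.1.2 := fun z => by ring
  rw [of_apply, integral_congr_ae (ae_of_all _ h), integral_add, integral_sub, integral_sub,
    integral_const_mul, integral_const_mul, integral_const, integral_mul_mul_mul_gaussLaw hR,
    integral_mul_gaussLaw hR, integral_mul_gaussLaw hR, productCov, of_apply]
  · simp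
    ring
  · exact hij
  · exact (hi _ _).const_mul _
  · exact hij.sub ((hi _ _).const_mul _)
  · exact (hi _ _).const_mul _
  · exact (hij.sub ((hi _ _).const_mul _)).sub ((hi _ _).const_mul _)
  · exact integrable_const _

theorem memLp_score (hR : R.PosDef) (i : SymIdx q) : MemLp (score R i) 2 (gaussLaw R) := by
  rw [funext (score_eq hR i)]
  exact memLp_finsetSum _ fun j _ => (memLp_productFluct hR j).const_mul _

/-- The scores are the combinations of the fluctuations `z a * z b - R a b` with coefficient matrix
`fisherTrace R`, and `fisherTrace R` inverts the covariance matrix of those fluctuations. -/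
theorem fisher_eq_fisherTrace (hR : R.PosDef) : fisher R = fisherTrace R := by
  have hsymm : (fisher R)ᵀ = fisher R := by
    ext i j
    simp only [fisher, transpose_apply, of_apply, mul_comm]
  have h : fisher R = fisherTrace R * productCov R * (fisherTrace R)ᵀ := by
    ext i j
    rw [productCov_eq_gram hR]
    simp only [fisher, of_apply, mul_apply, transpose_apply, score_eq hR, Finset.sum_mul]
    simp_rw [Finset.mul_sum]
    have hint : ∀ k l : SymIdx q, Integrable (fun z : Fin q → ℝ =>
        (z k.1.1 * z k.1.2 - R k.1.1 k.1.2) * (z l.1.1 * z l.1.2 - R l.1.1 l.1.2)) (gaussLaw R) :=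
      fun k l => (memLp_productFluct hR k).integrable_mul (memLp_productFluct hR l)
    have e : ∀ (k l : SymIdx q) (z : Fin q → ℝ),
        fisherTrace R i k * (z k.1.1 * z k.1.2 - R k.1.1 k.1.2) *
          (fisherTrace R j l * (z l.1.1 * z l.1.2 - R l.1.1 l.1.2)) =
        (fisherTrace R i k * fisherTrace R j l) * ((z k.1.1 * z k.1.2 - R k.1.1 k.1.2) *
          (z l.1.1 * z l.1.2 - R l.1.1 l.1.2)) := fun k l z => by ring
    simp_rw [e]
    rw [integral_finsetSum _ fun k _ => integrable_finsetSum _ fun l _ =>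
      (hint k l).const_mul _, Finset.sum_comm]
    refine Finset.sum_congr rfl fun k _ => ?_
    rw [integral_finsetSum _ fun l _ => (hint k l).const_mul _]
    refine Finset.sum_congr rfl fun l _ => ?_
    rw [integral_const_mul]
    ring
  rw [fisherTrace_mul_productCov hR, Matrix.one_mul] at h
  rw [← hsymm, h, transpose_transpose]

theorem inv_fisher (hR : R.PosDef) : (fisher R)⁻¹ = productCov R := by
  rw [fisher_eq_fisherTrace hR]
  exact inv_eq_right_inv (fisherTrace_mul_productCov hR)

theorem productCov_posSemidef (hR : R.PosDef) : (productCov R).PosSemidef := by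
  refine PosSemidef.of_dotProduct_mulVec_nonneg ?_ fun y => ?_
  · ext i j
    simp only [productCov_eq_gram hR, conjTranspose_apply, of_apply, star_trivial, mul_comm]
  · rw [productCov_eq_gram hR, star_trivial,
      dotProduct_gram_mulVec (fun i => memLp_productFluct hR i)]
    exact integral_nonneg fun z => sq_nonneg _

theorem fisher_posDef (hR : R.PosDef) : (fisher R).PosDef := by
  have h : IsUnit (productCov R) :=
    ⟨⟨productCov R, fisherTrace R, mul_eq_one_comm.1 (fisherTrace_mul_productCov hR),
      fisherTrace_mul_productCov hR⟩, rfl⟩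
  have := ((productCov_posSemidef hR).posDef_iff_isUnit.2 h).inv
  rwa [← inv_fisher hR, nonsing_inv_nonsing_inv] at this
  rw [fisher_eq_fisherTrace hR]
  exact isUnit_det_of_right_inverse (fisherTrace_mul_productCov hR)

theorem jacobian_apply_of_isLinearMap {κ : Type*}
    {g : Matrix (Fin q) (Fin q) ℝ → EuclideanSpace ℝ κ}
    (hg : IsLinearMap ℝ g) (R : Matrix (Fin q) (Fin q) ℝ) (k : κ) (i : SymIdx q) :
    jacobian g R k i = g (symDir i) k := by
  have h : ∀ t : ℝ, g (R + t • symDir i) k = g R k + t * g (symDir i) k := by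
    intro t
    rw [hg.map_add, hg.map_smul]
    simp
  rw [jacobian, of_apply]
  simp_rw [h]
  simp

/-- A linear map is recovered from its Jacobian on symmetric matrices. -/
theorem apply_eq_jacobian_of_isLinearMap {κ : Type*}
    {g : Matrix (Fin q) (Fin q) ℝ → EuclideanSpace ℝ κ}
    (hg : IsLinearMap ℝ g) (R : Matrix (Fin q) (Fin q) ℝ) {Q : Matrix (Fin q) (Fin q) ℝ}
    (hQ : Qᵀ = Q) (k : κ) :
    g Q k = ∑ i, jacobian g R k i * Q i.1.1 i.1.2 := by
  have h1 : g Q = ∑ i : SymIdx q, Q i.1.1 i.1.2 • g (symDir i) := by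
    conv_lhs => rw [← sum_smul_symDir hQ]
    have := map_sum hg.mk' (fun i : SymIdx q => Q i.1.1 i.1.2 • symDir i) Finset.univ
    simp only [IsLinearMap.mk'_apply, hg.map_smul] at this
    exact this
  rw [h1]
  simp only [WithLp.ofLp_sum, Finset.sum_apply, PiLp.smul_apply, smul_eq_mul,
    jacobian_apply_of_isLinearMap hg, mul_comm]

theorem transpose_average_vecMulVec (N : ℕ) (d : ℕ → Fin q → ℝ) :
    ((N : ℝ)⁻¹ • ∑ n ∈ Finset.range N, vecMulVec (d n) (d n))ᵀ =
      (N : ℝ)⁻¹ • ∑ n ∈ Finset.range N, vecMulVec (d n) (d n) := by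
  simp [transpose_sum, transpose_vecMulVec]

/-- Every linear function of the sample correlation matrix of independent Gaussian observations is
an asymptotically efficient estimator. By the Cramér–Wold device the central limit theorem is
applied to `∑ i, y i * z i.1.1 * z i.1.2` with `y = Jᵀ t`, and its variance is `y ⬝ᵥ I⁻¹ y`. -/
theorem isAsymptoticallyEfficient_of_isLinearMap {Ω κ : Type*} [MeasurableSpace Ω] [Fintype κ]
    [DecidableEq κ] {μ : Measure Ω} [IsProbabilityMeasure μ] {Z : ℕ → Ω → Fin q → ℝ}
    (hZ : ∀ n, Measurable (Z n)) (hindep : iIndepFun Z μ) (hR : R.PosDef)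
    (hlaw : ∀ n, μ.map (Z n) = gaussLaw R)
    {g : Matrix (Fin q) (Fin q) ℝ → EuclideanSpace ℝ κ} (hg : IsLinearMap ℝ g) :
    IsAsymptoticallyEfficient μ (fun N ω =>
      g ((N : ℝ)⁻¹ • ∑ n ∈ Finset.range N, vecMulVec (Z n ω) (Z n ω))) g R := by
  have hprob := isProbabilityMeasure_gaussLaw hR
  have hsymm : Rᵀ = R := by simpa using hR.isHermitian.eq
  have hJ := fun {Q : Matrix (Fin q) (Fin q) ℝ} (hQ : Qᵀ = Q) k =>
    apply_eq_jacobian_of_isLinearMap hg R hQ k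
  set J := jacobian g R with hJdef
  have hTm : ∀ N : ℕ, Measurable fun ω => Real.sqrt N •
      (g ((N : ℝ)⁻¹ • ∑ n ∈ Finset.range N, vecMulVec (Z n ω) (Z n ω)) - g R) := by
    intro N
    have h1 : ∀ ω, Real.sqrt N •
        (g ((N : ℝ)⁻¹ • ∑ n ∈ Finset.range N, vecMulVec (Z n ω) (Z n ω)) - g R) =
        WithLp.toLp 2 fun k => Real.sqrt N * (∑ i, J k i * ((N : ℝ)⁻¹ *
          ∑ n ∈ Finset.range N, Z n ω i.1.1 * Z n ω i.1.2) - g R k) := by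
      intro ω
      ext k
      rw [PiLp.smul_apply, PiLp.sub_apply, hJ (transpose_average_vecMulVec N fun n => Z n ω) k]
      simp only [Matrix.smul_apply, Matrix.sum_apply, vecMulVec_apply, smul_eq_mul]
    have h2 := fun n (a : Fin q) => (measurable_pi_apply a).comp (hZ n)
    simp only [Function.comp_def] at h2
    simp_rw [h1]
    fun_prop
  refine ⟨memLp_score hR, fisher_posDef hR, ⟨fun N => (hTm N).aemeasurable, by fun_prop, ?_⟩⟩
  refine ProbabilityMeasure.tendsto_of_tendsto_charFun fun t => ?_
  have hpsd : (cramerRao g R).PosSemidef := by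
    rw [cramerRao, inv_fisher hR, ← conjTranspose_eq_transpose_of_trivial]
    exact (productCov_posSemidef hR).mul_mul_conjTranspose_same _
  -- the scalar statistic belonging to the direction `t`
  let y : SymIdx q → ℝ := fun i => ∑ k, t k * J k i
  let Y : (Fin q → ℝ) → ℝ := fun z => ∑ i, y i * (z i.1.1 * z i.1.2)
  have hYm : Measurable Y := by fun_prop
  have hYL : MemLp Y 2 (gaussLaw R) :=
    memLp_finsetSum _ fun i _ => (memLp_mul_gaussLaw hR _ _).const_mul _
  have hYE : ∫ z, Y z ∂(gaussLaw R) = ∑ i, y i * R i.1.1 i.1.2 := by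
    simp only [Y]
    rw [integral_finsetSum _ fun i _ =>
      ((memLp_mul_gaussLaw hR _ _).integrable (by norm_num)).const_mul _]
    simp only [integral_const_mul, integral_mul_gaussLaw hR]
  have hYV : variance Y (gaussLaw R) = t.ofLp ⬝ᵥ (cramerRao g R).mulVec t.ofLp := by
    have h1 : t.ofLp ⬝ᵥ (cramerRao g R).mulVec t.ofLp = y ⬝ᵥ (productCov R).mulVec y := by
      have hy : y = Matrix.vecMul t.ofLp J := by
        funext i
        simp [y, vecMul, dotProduct]
      rw [cramerRao, inv_fisher hR, ← hJdef, ← mulVec_mulVec, ← mulVec_mulVec, mulVec_transpose,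
        ← hy, dotProduct_mulVec, ← hy]
    rw [h1, productCov_eq_gram hR, dotProduct_gram_mulVec (fun i => memLp_productFluct hR i),
      variance_eq_integral hYm.aemeasurable, hYE]
    simp only [Y, mul_sub, Finset.sum_sub_distrib]
  have hYZ : ∀ n, μ.map (fun ω => Y (Z n ω)) = (gaussLaw R).map Y := by
    intro n
    rw [← hlaw n, Measure.map_map hYm (hZ n)]
    rfl
  have hclt := tendstoInDistribution_inv_sqrt_mul_sum_sub (P := μ) (X := fun n ω => Y (Z n ω))
    (Y := id) (P' := gaussianReal 0 (variance (fun ω => Y (Z 0 ω)) μ).toNNReal)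
    ⟨aemeasurable_id, Measure.map_id⟩
    (by
      rw [← hlaw 0] at hYL
      exact hYL.comp_of_map (hZ 0).aemeasurable)
    (hindep.comp (fun _ => Y) (fun _ => hYm))
    (fun n => ⟨(hYm.comp (hZ n)).aemeasurable, (hYm.comp (hZ 0)).aemeasurable,
      by rw [hYZ, hYZ]⟩)
  have hmean : ∫ ω, Y (Z 0 ω) ∂μ = ∑ i, y i * R i.1.1 i.1.2 := by
    rw [← hYE, ← hlaw 0, integral_map (hZ 0).aemeasurable hYm.aestronglyMeasurable]
  have hvar : variance (fun ω => Y (Z 0 ω)) μ = t.ofLp ⬝ᵥ (cramerRao g R).mulVec t.ofLp := by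
    rw [← hYV, ← hlaw 0, variance_map hYm.aemeasurable (hZ 0).aemeasurable]
    rfl
  have h0 : 0 ≤ t.ofLp ⬝ᵥ (cramerRao g R).mulVec t.ofLp := by
    simpa using hpsd.dotProduct_mulVec_nonneg t.ofLp
  have hlim := ProbabilityMeasure.tendsto_iff_tendsto_charFun.1 hclt.tendsto 1
  simp only [ProbabilityMeasure.coe_mk, Measure.map_id, Measure.map_id'] at hlim ⊢
  rw [charFun_gaussianReal, hvar, Real.coe_toNNReal _ h0] at hlim
  rw [charFun_multivariateGaussian hpsd]
  have hrhs : ((inner ℝ t (0 : EuclideanSpace ℝ κ) : ℝ) : ℂ) * Complex.I -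
      ((t.ofLp ⬝ᵥ (cramerRao g R).mulVec t.ofLp : ℝ) : ℂ) / 2 =
      ((1 : ℝ) : ℂ) * ((0 : ℝ) : ℂ) * Complex.I -
      ((t.ofLp ⬝ᵥ (cramerRao g R).mulVec t.ofLp : ℝ) : ℂ) * ((1 : ℝ) : ℂ) ^ 2 / 2 := by
    simp
  rw [hrhs]
  refine hlim.congr fun N => ?_
  have hsm : Measurable fun ω => (Real.sqrt N)⁻¹ * (∑ k ∈ Finset.range N, Y (Z k ω) -
      N * ∫ ω, Y (Z 0 ω) ∂μ) := by
    have := fun k => hYm.comp (hZ k)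
    simp only [Function.comp_def] at this
    fun_prop
  rw [charFun_apply, charFun_apply, integral_map (hTm N).aemeasurable (by fun_prop),
    integral_map hsm.aemeasurable (by fun_prop)]
  refine integral_congr_ae (ae_of_all _ fun ω => ?_)
  refine congrArg (fun r : ℝ => Complex.exp ((r : ℂ) * Complex.I)) ?_
  -- `⟪√N (g S - g R), t⟫ = √N (∑ y S - ∑ y R)`
  have hS := transpose_average_vecMulVec N fun n => Z n ω
  have hlin : ∀ {Q : Matrix (Fin q) (Fin q) ℝ}, Qᵀ = Q →
      ∑ k, t k * g Q k = ∑ i, y i * Q i.1.1 i.1.2 := by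
    intro Q hQ
    simp only [hJ hQ, y, Finset.mul_sum, Finset.sum_mul]
    rw [Finset.sum_comm]
    refine Finset.sum_congr rfl fun i _ => Finset.sum_congr rfl fun k _ => by ring
  have hT : inner ℝ (Real.sqrt N • (g ((N : ℝ)⁻¹ • ∑ n ∈ Finset.range N,
      vecMulVec (Z n ω) (Z n ω)) - g R)) t = Real.sqrt N * ((N : ℝ)⁻¹ *
        ∑ n ∈ Finset.range N, Y (Z n ω) - ∑ i, y i * R i.1.1 i.1.2) := by
    rw [real_inner_smul_left, inner_sub_left, EuclideanSpace.inner_eq_star_dotProduct,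
      EuclideanSpace.inner_eq_star_dotProduct]
    simp only [star_trivial, dotProduct, hlin hS, hlin hsymm]
    congr 2
    simp only [Y, Matrix.smul_apply, Matrix.sum_apply, vecMulVec_apply, smul_eq_mul]
    rw [Finset.sum_comm, Finset.mul_sum]
    refine Finset.sum_congr rfl fun i _ => ?_
    rw [← Finset.mul_sum]
    ring
  rw [hT, hmean]
  simp only [inner, one_mul, RCLike.re_to_real, star_trivial]
  rcases Nat.eq_zero_or_pos N with rfl | hN
  · simp
  have hN' : (0 : ℝ) < N := by exact_mod_cast hN
  have hs : Real.sqrt N * Real.sqrt N = N := Real.mul_self_sqrt hN'.le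
  have hs0 : Real.sqrt N ≠ 0 := (Real.sqrt_pos.2 hN').ne'
  rw [inv_mul_eq_iff_eq_mul₀ hs0, ← mul_assoc, hs]
  field_simp

end Efficiency

/-! ### Almost sure nonsingularity of the sample correlation matrix -/

section SamplePosDef
variable {q : ℕ}

/-- At most `q` vectors drawn independently from an absolutely continuous law on `ℝ^q` are
linearly independent almost surely: given the others, each avoids their span, which is a proper
subspace. -/
theorem ae_linearIndependent_pi {ν : Measure (Fin q → ℝ)} [IsProbabilityMeasure ν]
    (hν : ν ≪ volume) {k : ℕ} (hk : k ≤ q) :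
    ∀ᵐ z ∂(Measure.pi fun _ : Fin k => ν), LinearIndependent ℝ z := by
  induction k with
  | zero => exact ae_of_all _ fun z => linearIndependent_empty_type
  | succ k ih =>
    have ih := ih (by omega)
    have hmp := measurePreserving_piFinSuccAbove (fun _ : Fin (k + 1) => ν) 0
    have hmeas : MeasurableSet {p : (Fin q → ℝ) × (Fin k → Fin q → ℝ) |
        LinearIndependent ℝ (Fin.cons p.1 p.2 : Fin (k + 1) → Fin q → ℝ)} := by
      have hc : Continuous fun p : (Fin q → ℝ) × (Fin k → Fin q → ℝ) =>
          (Fin.cons p.1 p.2 : Fin (k + 1) → Fin q → ℝ) := by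
        refine continuous_pi fun i => ?_
        refine Fin.cases ?_ (fun j => ?_) i
        · simpa using continuous_fst
        · simp only [Fin.cons_succ]
          fun_prop
      exact (isOpen_setOfPred_linearIndependent.preimage hc).measurableSet
    have hprod : ∀ᵐ p ∂(ν.prod (Measure.pi fun _ : Fin k => ν)),
        LinearIndependent ℝ (Fin.cons p.1 p.2 : Fin (k + 1) → Fin q → ℝ) := by
      rw [ae_iff, ← Set.compl_ofPred, Measure.prod_apply_symm hmeas.compl,
        lintegral_eq_zero_iff (measurable_measure_prodMk_right hmeas.compl)]
      filter_upwards [ih] with y hy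
      refine measure_mono_null (t := (Submodule.span ℝ (Set.range y) : Set (Fin q → ℝ))) ?_ ?_
      · intro x hx
        by_contra hxs
        exact hx (linearIndependent_finCons.2 ⟨hy, hxs⟩)
      · refine hν (Measure.addHaar_submodule _ _ fun htop => ?_)
        have h1 := finrank_range_le_card (R := ℝ) y
        rw [Set.finrank, htop, finrank_top] at h1
        simp at h1
        omega
    have := hmp.quasiMeasurePreserving.ae hprod
    filter_upwards [this] with z hz
    convert! hz using 1
    funext i
    refine Fin.cases ?_ (fun j => ?_) i <;> rfl

theorem average_vecMulVec_posDef {N : ℕ} (hN : q ≤ N) (hq : 0 < q) {d : ℕ → Fin q → ℝ}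
    (hd : LinearIndependent ℝ fun i : Fin q => d i) :
    ((N : ℝ)⁻¹ • ∑ n ∈ Finset.range N, vecMulVec (d n) (d n)).PosDef := by
  have hN' : (0 : ℝ) < (N : ℝ)⁻¹ := by
    have : 0 < N := by omega
    positivity
  refine PosDef.of_dotProduct_mulVec_pos ?_ fun {x} hx => ?_
  · rw [IsHermitian, conjTranspose_eq_transpose_of_trivial]
    exact transpose_average_vecMulVec N d
  · have h : star x ⬝ᵥ ((N : ℝ)⁻¹ • ∑ n ∈ Finset.range N, vecMulVec (d n) (d n)).mulVec x =
        (N : ℝ)⁻¹ * ∑ n ∈ Finset.range N, (d n ⬝ᵥ x) ^ 2 := by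
      rw [star_trivial, smul_mulVec, dotProduct_smul, smul_eq_mul, sum_mulVec, dotProduct_sum]
      congr 1
      refine Finset.sum_congr rfl fun n _ => ?_
      rw [vecMulVec_mulVec, dotProduct_smul, MulOpposite.smul_eq_mul_unop, MulOpposite.unop_op,
        dotProduct_comm x, sq]
    rw [h]
    refine mul_pos hN' ((Finset.sum_nonneg fun n _ => sq_nonneg _).lt_of_ne' fun h0 => hx ?_)
    rw [Finset.sum_eq_zero_iff_of_nonneg fun n _ => sq_nonneg _] at h0
    have hspan : Submodule.span ℝ (Set.range fun i : Fin q => d i) = ⊤ :=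
      hd.span_eq_top_of_card_eq_finrank' (by simp)
    have hall : ∀ w ∈ Submodule.span ℝ (Set.range fun i : Fin q => d i), w ⬝ᵥ x = 0 := by
      intro w hw
      induction hw using Submodule.span_induction with
      | mem w hw =>
        obtain ⟨i, rfl⟩ := hw
        exact pow_eq_zero_iff (two_ne_zero) |>.1 (h0 i (Finset.mem_range.2 (by omega)))
      | zero => simp
      | add u w _ _ hu hw => rw [add_dotProduct, hu, hw, add_zero]
      | smul r w _ hw => rw [smul_dotProduct, hw, smul_zero]
    exact dotProduct_self_eq_zero.1 (hall x (by rw [hspan]; trivial))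

/-- The first `q` observations already span `ℝ^q` almost surely. -/
theorem ae_average_vecMulVec_posDef {Ω : Type*} [MeasurableSpace Ω] {μ : Measure Ω}
    [IsProbabilityMeasure μ] {R : Matrix (Fin q) (Fin q) ℝ} {Z : ℕ → Ω → Fin q → ℝ} (hq : 0 < q)
    (hZ : ∀ n, Measurable (Z n)) (hindep : iIndepFun Z μ) (hR : R.PosDef)
    (hlaw : ∀ n, μ.map (Z n) = gaussLaw R) :
    ∀ᵐ ω ∂μ, ∀ N : ℕ, q ≤ N →
      ((N : ℝ)⁻¹ • ∑ n ∈ Finset.range N, vecMulVec (Z n ω) (Z n ω)).PosDef := by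
  have := isProbabilityMeasure_gaussLaw hR
  have hjoint : μ.map (fun ω (i : Fin q) => Z i ω) = Measure.pi fun _ : Fin q => gaussLaw R := by
    have h1 := hindep.precomp (g := fun i : Fin q => (i : ℕ)) Fin.val_injective
    rw [(iIndepFun_iff_map_fun_eq_pi_map (f := fun i : Fin q => Z i) fun i => (hZ i).aemeasurable).1
      h1]
    simp only [hlaw]
  have hae := ae_linearIndependent_pi (ν := gaussLaw R)
    (withDensity_absolutelyContinuous _ _) le_rfl
  rw [← hjoint] at hae
  filter_upwards [ae_of_ae_map (by fun_prop) hae] with ω hω N hN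
  exact average_vecMulVec_posDef hN hq hω

end SamplePosDef

/-! ### Mean square convergence and the spectral isometry -/

section L2

variable {α 𝕜 : Type*} [RCLike 𝕜] [MeasurableSpace α] {ν : Measure α}

theorem tendsto_integral_inner_of_tendsto_eLpNorm {f g : ℕ → α → 𝕜} {f' g' : α → 𝕜}
    (hf : ∀ n, MemLp (f n) 2 ν) (hf' : MemLp f' 2 ν) (hg : ∀ n, MemLp (g n) 2 ν)
    (hg' : MemLp g' 2 ν) (hfl : Tendsto (fun n => eLpNorm (f n - f') 2 ν) atTop (𝓝 0))
    (hgl : Tendsto (fun n => eLpNorm (g n - g') 2 ν) atTop (𝓝 0)) :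
    Tendsto (fun n => ∫ a, inner 𝕜 (f n a) (g n a) ∂ν) atTop
      (𝓝 (∫ a, inner 𝕜 (f' a) (g' a) ∂ν)) := by
  have h1 := (Lp.tendsto_Lp_iff_tendsto_eLpNorm'' f hf f' hf').2 hfl
  have h2 := (Lp.tendsto_Lp_iff_tendsto_eLpNorm'' g hg g' hg').2 hgl
  have h3 := h1.inner (𝕜 := 𝕜) h2
  have e : ∀ {f g : α → 𝕜} (hf : MemLp f 2 ν) (hg : MemLp g 2 ν),
      inner 𝕜 (hf.toLp f) (hg.toLp g) = ∫ a, inner 𝕜 (f a) (g a) ∂ν := by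
    intro f g hf hg
    rw [L2.inner_def]
    refine integral_congr_ae ?_
    filter_upwards [hf.coeFn_toLp, hg.coeFn_toLp] with a h1 h2
    rw [h1, h2]
  simpa only [e] using h3

theorem eLpNorm_two_eq_ofReal_sqrt {f : α → 𝕜} (hf : MemLp f 2 ν) :
    eLpNorm f 2 ν = ENNReal.ofReal (Real.sqrt (∫ a, ‖f a‖ ^ 2 ∂ν)) := by
  rw [hf.eLpNorm_eq_integral_rpow_norm (by norm_num) (by norm_num), Real.sqrt_eq_rpow]
  simp

end L2

section Spectral

variable {Ω ι κ : Type*} [MeasurableSpace Ω] {μ : Measure Ω} {x : ℝ → Ω → ℝ} {P : ℝ → ℝ}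

/-- The spectral measure `P(w) dw`. -/
noncomputable def specMeasure (P : ℝ → ℝ) : Measure ℝ :=
  volume.withDensity fun w => ENNReal.ofReal (P w)

/-- The linear combination `∑ a_i x(s_i)` of samples of the process. -/
def sampleSum (x : ℝ → Ω → ℝ) (S : Finset ι) (a s : ι → ℝ) (ω : Ω) : ℝ :=
  ∑ i ∈ S, a i * x (s i) ω

/-- The exponential sum `∑ a_i e^{j w s_i}` which represents `∑ a_i x(s_i)` in the spectral
domain. -/
noncomputable def expSum (S : Finset ι) (a s : ι → ℝ) (w : ℝ) : ℂ :=
  ∑ i ∈ S, (a i : ℂ) * Complex.exp (Complex.I * w * s i)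

theorem integral_specMeasure (hi : Integrable P) (h0 : ∀ w, 0 ≤ P w) (f : ℝ → ℂ) :
    ∫ w, f w ∂(specMeasure P) = ∫ w, (P w : ℂ) * f w := by
  rw [specMeasure, integral_withDensity_eq_integral_toReal_smul₀
    hi.aestronglyMeasurable.aemeasurable.ennreal_ofReal (by simp)]
  refine integral_congr_ae (ae_of_all _ fun w => ?_)
  simp [ENNReal.toReal_ofReal (h0 w)]

theorem isFiniteMeasure_specMeasure (hi : Integrable P) : IsFiniteMeasure (specMeasure P) :=
  isFiniteMeasure_withDensity_ofReal hi.2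

theorem continuous_expSum (S : Finset ι) (a s : ι → ℝ) : Continuous (expSum S a s) := by
  unfold expSum
  fun_prop

theorem norm_exp_I_mul_mul (w s : ℝ) : ‖Complex.exp (Complex.I * w * s)‖ = 1 := by
  rw [show Complex.I * w * s = ((w * s : ℝ) : ℂ) * Complex.I by push_cast; ring,
    Complex.norm_exp_ofReal_mul_I]

theorem memLp_expSum (hi : Integrable P) (S : Finset ι) (a s : ι → ℝ) (p : ENNReal) :
    MemLp (expSum S a s) p (specMeasure P) := by
  have := isFiniteMeasure_specMeasure hi
  refine MemLp.of_bound (continuous_expSum S a s).aestronglyMeasurable (∑ i ∈ S, |a i|)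
    (ae_of_all _ fun w => (norm_sum_le _ _).trans (Finset.sum_le_sum fun i _ => ?_))
  rw [norm_mul, norm_exp_I_mul_mul]
  simp

theorem memLp_sampleSum (hx : IsGaussianWSS x μ) (S : Finset ι) (a s : ι → ℝ) :
    MemLp (sampleSum x S a s) 2 μ :=
  memLp_finsetSum _ fun i _ => ((hx.gaussian.hasGaussianLaw_eval (s i)).memLp_two).const_mul _

theorem inner_expSum (S : Finset ι) (T : Finset κ) (a s : ι → ℝ) (b t : κ → ℝ) (w : ℝ) :
    inner ℂ (expSum T b t w) (expSum S a s w) =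
      ∑ i ∈ S, ∑ j ∈ T, ((a i * b j : ℝ) : ℂ) *
        Complex.exp (Complex.I * w * ((s i - t j : ℝ) : ℂ)) := by
  rw [RCLike.inner_apply, expSum, expSum, map_sum, Finset.sum_mul_sum]
  refine Finset.sum_congr rfl fun i _ => Finset.sum_congr rfl fun j _ => ?_
  rw [map_mul, ← Complex.exp_conj, map_mul, map_mul]
  simp only [Complex.conj_ofReal, Complex.conj_I]
  rw [mul_mul_mul_comm, ← Complex.exp_add]
  push_cast
  ring_nf

/-- Spectral isometry: samples of the process correlate like the corresponding exponentials in
`L²(P dw)`, up to the factor `2π`. -/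
theorem integral_sampleSum_mul_sampleSum (hx : IsGaussianWSS x μ)
    (hP : IsPowerSpectralDensity (autocorr x μ) P) (S : Finset ι) (T : Finset κ) (a s : ι → ℝ)
    (b t : κ → ℝ) :
    ((∫ ω, sampleSum x S a s ω * sampleSum x T b t ω ∂μ : ℝ) : ℂ) =
      (1 / (2 * Real.pi) : ℂ) *
        ∫ w, inner ℂ (expSum T b t w) (expSum S a s w) ∂(specMeasure P) := by
  have := isFiniteMeasure_specMeasure hP.integrable
  have hm := fun t => (hx.gaussian.hasGaussianLaw_eval t).memLp_two
  have hxx : ∀ s t, Integrable (fun ω => x s ω * x t ω) μ := fun s t => (hm s).integrable_mul (hm t)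
  have h1 : ∫ ω, sampleSum x S a s ω * sampleSum x T b t ω ∂μ =
      ∑ i ∈ S, ∑ j ∈ T, (a i * b j) * autocorr x μ (s i - t j) := by
    have e : ∀ ω, sampleSum x S a s ω * sampleSum x T b t ω =
        ∑ i ∈ S, ∑ j ∈ T, (a i * b j) * (x (s i) ω * x (t j) ω) := by
      intro ω
      rw [sampleSum, sampleSum, Finset.sum_mul_sum]
      refine Finset.sum_congr rfl fun i _ => Finset.sum_congr rfl fun j _ => by ring
    simp_rw [e]
    rw [integral_finsetSum _ fun i _ => integrable_finsetSum _ fun j _ => (hxx _ _).const_mul _]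
    refine Finset.sum_congr rfl fun i _ => ?_
    rw [integral_finsetSum _ fun j _ => (hxx _ _).const_mul _]
    refine Finset.sum_congr rfl fun j _ => ?_
    rw [integral_const_mul, hx.stationary, autocorr]
  have hexp : ∀ τ : ℝ,
      Integrable (fun w : ℝ => Complex.exp (Complex.I * w * τ)) (specMeasure P) := by
    intro τ
    refine Integrable.of_bound (C := 1) (Continuous.aestronglyMeasurable (by fun_prop))
      (ae_of_all _ fun w => (norm_exp_I_mul_mul w τ).le)
  simp_rw [inner_expSum]
  rw [h1, integral_finsetSum _ fun i _ => integrable_finsetSum _ fun j _ => (hexp _).const_mul _,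
    Finset.mul_sum]
  push_cast
  refine Finset.sum_congr rfl fun i _ => ?_
  rw [integral_finsetSum _ fun j _ => by simpa using (hexp (s i - t j)).const_mul _, Finset.mul_sum]
  refine Finset.sum_congr rfl fun j _ => ?_
  rw [integral_const_mul, hP.fourier, integral_specMeasure hP.integrable hP.nonneg]
  push_cast
  ring

/-- The norm version of the spectral isometry. -/
theorem eLpNorm_expSum (hx : IsGaussianWSS x μ)
    (hP : IsPowerSpectralDensity (autocorr x μ) P) (S : Finset ι) (a s : ι → ℝ) :
    eLpNorm (expSum S a s) 2 (specMeasure P) =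
      ENNReal.ofReal (Real.sqrt (2 * Real.pi)) * eLpNorm (sampleSum x S a s) 2 μ := by
  rw [eLpNorm_two_eq_ofReal_sqrt (memLp_expSum hP.integrable S a s 2),
    eLpNorm_two_eq_ofReal_sqrt (memLp_sampleSum hx S a s), ← ENNReal.ofReal_mul (by positivity),
    ← Real.sqrt_mul (by positivity)]
  congr 2
  have h := integral_sampleSum_mul_sampleSum hx hP S S a s a s
  simp only [inner_self_eq_norm_sq_to_K, Complex.coe_algebraMap] at h
  have h2 : ∫ w, (‖expSum S a s w‖ : ℂ) ^ 2 ∂(specMeasure P) =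
      ((∫ w, ‖expSum S a s w‖ ^ 2 ∂(specMeasure P) : ℝ) : ℂ) := by
    rw [← integral_complex_ofReal]
    push_cast
    rfl
  rw [h2] at h
  have h3 : ∫ ω, ‖sampleSum x S a s ω‖ ^ 2 ∂μ =
      ∫ ω, sampleSum x S a s ω * sampleSum x S a s ω ∂μ := by
    refine integral_congr_ae (ae_of_all _ fun ω => ?_)
    simp only [Real.norm_eq_abs, sq_abs]
    ring
  rw [h3]
  have h4 : (∫ ω, sampleSum x S a s ω * sampleSum x S a s ω ∂μ : ℝ) =
      1 / (2 * Real.pi) * ∫ w, ‖expSum S a s w‖ ^ 2 ∂(specMeasure P) := by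
    exact_mod_cast h
  rw [h4]
  field_simp

theorem eLpNorm_expSum_sub_expSum (hx : IsGaussianWSS x μ)
    (hP : IsPowerSpectralDensity (autocorr x μ) P) (S T : Finset ι) (a s : ι → ℝ) :
    eLpNorm (expSum S a s - expSum T a s) 2 (specMeasure P) =
      ENNReal.ofReal (Real.sqrt (2 * Real.pi)) *
        eLpNorm (sampleSum x S a s - sampleSum x T a s) 2 μ := by
  have h := eLpNorm_expSum hx hP (S.disjSum T) (Sum.elim a (-a)) (Sum.elim s s)
  have e1 : expSum (S.disjSum T) (Sum.elim a (-a)) (Sum.elim s s) =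
      expSum S a s - expSum T a s := by
    funext w
    simp [expSum, Finset.sum_disjSum, sub_eq_add_neg]
  have e2 : sampleSum x (S.disjSum T) (Sum.elim a (-a)) (Sum.elim s s) =
      sampleSum x S a s - sampleSum x T a s := by
    funext w
    simp [sampleSum, Finset.sum_disjSum, sub_eq_add_neg]
  rwa [e1, e2] at h

/-- If sums of samples converge in mean square and a subsequence of the exponential sums which
represent them converges almost everywhere to `G`, then the exponential sums converge to `G` in
`L²(P dw)`: by the spectral isometry they form a Cauchy sequence, so Fatou's lemma applies. -/
theorem tendsto_eLpNorm_expSum_sub (hx : IsGaussianWSS x μ)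
    (hP : IsPowerSpectralDensity (autocorr x μ) P) {S : ℕ → Finset ι} {a s : ι → ℝ}
    {Z : Ω → ℝ} (hZ : MemLp Z 2 μ)
    (hlim : Tendsto (fun M => eLpNorm (sampleSum x (S M) a s - Z) 2 μ) atTop (𝓝 0))
    {φ : ℕ → ℕ} (hφ : StrictMono φ) {G : ℝ → ℂ}
    (hae : ∀ᵐ w, Tendsto (fun k => expSum (S (φ k)) a s w) atTop (𝓝 (G w))) :
    Tendsto (fun M => eLpNorm (expSum (S M) a s - G) 2 (specMeasure P)) atTop (𝓝 0) := by
  set C := ENNReal.ofReal (Real.sqrt (2 * Real.pi)) with hC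
  have hCtop : C ≠ ⊤ := ENNReal.ofReal_ne_top
  have hX := fun M => (memLp_sampleSum hx (S M) a s).aestronglyMeasurable
  have hE := fun M => (memLp_expSum hP.integrable (S M) a s 2).aestronglyMeasurable
  have hae' : ∀ᵐ w ∂(specMeasure P), Tendsto (fun k => expSum (S (φ k)) a s w) atTop (𝓝 (G w)) :=
    (withDensity_absolutelyContinuous _ _).ae_le hae
  have hbound : ∀ M, eLpNorm (expSum (S M) a s - G) 2 (specMeasure P) ≤
      C * eLpNorm (sampleSum x (S M) a s - Z) 2 μ := by
    intro M
    have h1 := Lp.eLpNorm_lim_le_liminf_eLpNorm (p := 2)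
      (f := fun k => expSum (S M) a s - expSum (S (φ k)) a s)
      (fun k => (hE M).sub (hE (φ k))) (expSum (S M) a s - G)
      (by filter_upwards [hae'] with w hw using hw.const_sub _)
    refine h1.trans ?_
    have h2 : Tendsto (fun k => C * (eLpNorm (sampleSum x (S M) a s - Z) 2 μ +
        eLpNorm (sampleSum x (S (φ k)) a s - Z) 2 μ)) atTop
        (𝓝 (C * (eLpNorm (sampleSum x (S M) a s - Z) 2 μ + 0))) :=
      ENNReal.Tendsto.const_mul (tendsto_const_nhds.add (hlim.comp hφ.tendsto_atTop)) (Or.inr hCtop)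
    rw [add_zero] at h2
    rw [← h2.liminf_eq]
    refine liminf_le_liminf (Eventually.of_forall fun k => ?_)
    rw [eLpNorm_expSum_sub_expSum hx hP]
    gcongr
    have e : sampleSum x (S M) a s - sampleSum x (S (φ k)) a s =
        (sampleSum x (S M) a s - Z) - (sampleSum x (S (φ k)) a s - Z) := by abel
    rw [e]
    exact eLpNorm_sub_le ((hX M).sub hZ.1) ((hX _).sub hZ.1) (by norm_num)
  have h0 : Tendsto (fun M => C * eLpNorm (sampleSum x (S M) a s - Z) 2 μ) atTop (𝓝 0) := by
    simpa using ENNReal.Tendsto.const_mul hlim (Or.inr hCtop)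
  exact tendsto_of_tendsto_of_tendsto_of_le_of_le tendsto_const_nhds h0 (fun _ => zero_le) hbound

end Spectral

/-! ### Fourier series of the ideal fractional delay filter -/

section DelayFilter

theorem intervalIntegral_exp_eq_sinc (β : ℝ) :
    ∫ x in (-(1 / 2) : ℝ)..(1 / 2), Complex.exp (-(2 * Real.pi * β * x : ℝ) * Complex.I) =
      (Real.sinc (Real.pi * β) : ℂ) := by
  rcases eq_or_ne β 0 with rfl | hβ
  · simp
    norm_num
  have hc : (-(2 * Real.pi * β)) ≠ 0 := by
    have := Real.pi_ne_zero
    simp [hβ, this]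
  have h1 : ∀ x : ℝ, Complex.exp (-(2 * Real.pi * β * x : ℝ) * Complex.I) =
      (fun t : ℝ => Complex.exp (t * Complex.I)) (-(2 * Real.pi * β) * x) := by
    intro x
    push_cast
    ring_nf
  simp_rw [h1]
  rw [intervalIntegral.integral_comp_mul_left (fun t : ℝ => Complex.exp (t * Complex.I)) hc]
  have e1 : -(2 * Real.pi * β) * (-(1 / 2)) = -(-(Real.pi * β)) := by ring
  have e2 : -(2 * Real.pi * β) * (1 / 2) = -(Real.pi * β) := by ring
  rw [e1, e2, integral_exp_mul_I_eq_sinc, Real.sinc_neg, Complex.real_smul]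
  have h3 : (Real.pi : ℂ) ≠ 0 := by exact_mod_cast Real.pi_ne_zero
  have h4 : (β : ℂ) ≠ 0 := by exact_mod_cast hβ
  push_cast
  field_simp

/-- The frequency response of the delay by `α` samples, as a function on the circle of
frequencies. -/
noncomputable def delayResponse (α : ℝ) : UnitAddCircle → ℂ := fun s =>
  Complex.exp (-(2 * Real.pi * α *
    (AddCircle.measurableEquivIco 1 (-(1 / 2)) s : ℝ) : ℝ) * Complex.I)

theorem delayResponse_coe (α s : ℝ) : delayResponse α (s : UnitAddCircle) =
    Complex.exp (-(2 * Real.pi * α * (s - round s) : ℝ) * Complex.I) := by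
  have hmem : s - round s ∈ Set.Ico (-(1 / 2) : ℝ) (-(1 / 2) + 1) := by
    have := (round_eq_iff (x := s) (n := round s)).1 rfl
    rw [Set.mem_Ico] at this ⊢
    constructor <;> linarith [this.1, this.2]
  have hs : (s : UnitAddCircle) = ((s - round s : ℝ) : UnitAddCircle) := by
    have h0 : ((round s : ℝ) : UnitAddCircle) = 0 :=
      (AddCircle.coe_eq_zero_iff 1).2 ⟨round s, by simp⟩
    rw [AddCircle.coe_sub, h0, sub_zero]
  rw [delayResponse, hs]
  have : (AddCircle.measurableEquivIco (1 : ℝ) (-(1 / 2)) ((s - round s : ℝ) : UnitAddCircle)) =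
      ⟨s - round s, hmem⟩ := by
    exact AddCircle.equivIco_coe_eq hmem
  rw [this]

theorem memLp_delayResponse (α : ℝ) : MemLp (delayResponse α) 2 AddCircle.haarAddCircle := by
  refine MemLp.of_bound (Measurable.aestronglyMeasurable ?_) 1 (ae_of_all _ fun s => ?_)
  · unfold delayResponse
    have := (AddCircle.measurableEquivIco (1 : ℝ) (-(1 / 2))).measurable
    fun_prop
  · rw [delayResponse, ← Complex.ofReal_neg, Complex.norm_exp_ofReal_mul_I]

/-- The Fourier coefficients of the frequency response are the samples of the shifted `sinc`. -/
theorem fourierCoeff_delayResponse (α : ℝ) (n : ℤ) :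
    fourierCoeff (delayResponse α) n = (Real.sinc (Real.pi * (n + α)) : ℂ) := by
  rw [fourierCoeff_eq_intervalIntegral _ _ (-(1 / 2)), ← intervalIntegral_exp_eq_sinc]
  have e : (-(1 / 2) : ℝ) + 1 = 1 / 2 := by norm_num
  rw [e, div_one, one_smul]
  refine intervalIntegral.integral_congr_Ioo_of_le (by norm_num) fun x hx => ?_
  have hr : round x = 0 := round_eq_zero_iff.2 ⟨hx.1.le, hx.2⟩
  rw [delayResponse_coe, hr, fourier_coe_apply, smul_eq_mul, ← Complex.exp_add]
  congr 1
  push_cast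
  ring

theorem ae_unitAddCircle_coe {p : UnitAddCircle → Prop}
    (h : ∀ᵐ s ∂(volume : Measure UnitAddCircle), p s) :
    ∀ᵐ s : ℝ, p s := by
  rw [← Measure.restrict_univ (μ := (volume : Measure ℝ)), ← iUnion_Ioc_intCast (α := ℝ),
    ae_restrict_iUnion_iff]
  intro n
  exact (AddCircle.measurePreserving_mk (1 : ℝ) n).quasiMeasurePreserving.ae h

/-- Symmetric partial sums of the frequency response of the ideal delay filter converge almost
everywhere, along a subsequence, to the delay by `α` samples of the frequency reduced modulo the
sampling rate: the Fourier series converges in `L²` of the circle. -/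
theorem exists_subseq_tendsto_sinc_sum (α : ℝ) :
    ∃ φ : ℕ → ℕ, StrictMono φ ∧ ∀ᵐ s : ℝ, Tendsto (fun k =>
      ∑ m ∈ Finset.Icc (-(φ k : ℤ)) (φ k), (Real.sinc (Real.pi * (m - α)) : ℂ) *
        Complex.exp (-(2 * Real.pi * m * s : ℝ) * Complex.I)) atTop
      (𝓝 (Complex.exp (-(2 * Real.pi * α * (s - round s) : ℝ) * Complex.I))) := by
  have hmem := memLp_delayResponse α
  have hsum := hasSum_fourier_series_L2 (hmem.toLp _)
  have hIcc : Tendsto (fun M : ℕ => Finset.Icc (-(M : ℤ)) M) atTop atTop := by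
    refine tendsto_atTop_finset_of_monotone
      (fun a b h => Finset.Icc_subset_Icc (by omega) (by omega))
      fun m => ⟨m.natAbs, by rw [Finset.mem_Icc]; omega⟩
  have hL2 := hsum.comp hIcc
  obtain ⟨φ, hφ, hae⟩ := (tendstoInMeasure_of_tendsto_Lp hL2).exists_seq_tendsto_ae
  refine ⟨φ, hφ, ?_⟩
  have hae1 : ∀ᵐ s ∂(AddCircle.haarAddCircle : Measure UnitAddCircle), Tendsto (fun k =>
      ∑ m ∈ Finset.Icc (-(φ k : ℤ)) (φ k), (Real.sinc (Real.pi * (m + α)) : ℂ) * fourier m s)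
      atTop (𝓝 (delayResponse α s)) := by
    have hterm : ∀ S : Finset ℤ, (((∑ m ∈ S, fourierCoeff (hmem.toLp (delayResponse α)) m •
        fourierLp 2 m : Lp ℂ 2 (AddCircle.haarAddCircle (T := (1 : ℝ))))) : UnitAddCircle → ℂ)
        =ᵐ[AddCircle.haarAddCircle] fun s =>
          ∑ m ∈ S, (Real.sinc (Real.pi * (m + α)) : ℂ) * fourier m s := by
      intro S
      have h1 : ∀ᵐ s ∂(AddCircle.haarAddCircle : Measure UnitAddCircle), ∀ m : ℤ,
          (fourierLp 2 m : Lp ℂ 2 (AddCircle.haarAddCircle (T := (1 : ℝ)))) s = fourier m s :=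
        ae_all_iff.2 fun m => coeFn_fourierLp 2 m
      have h2 : ∀ᵐ s ∂(AddCircle.haarAddCircle : Measure UnitAddCircle), ∀ m : ℤ,
          (fourierCoeff (hmem.toLp (delayResponse α)) m •
            fourierLp 2 m : Lp ℂ 2 (AddCircle.haarAddCircle (T := (1 : ℝ)))) s =
          fourierCoeff (hmem.toLp (delayResponse α)) m • (fourierLp 2 m :
            Lp ℂ 2 (AddCircle.haarAddCircle (T := (1 : ℝ)))) s :=
        ae_all_iff.2 fun m => Lp.coeFn_smul _ _
      filter_upwards [h1, h2, Lp.coeFn_finsetSum S fun m =>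
        fourierCoeff (hmem.toLp (delayResponse α)) m •
        (fourierLp 2 m : Lp ℂ 2 (AddCircle.haarAddCircle (T := (1 : ℝ))))] with s h1 h2 h3
      rw [h3, Finset.sum_apply]
      refine Finset.sum_congr rfl fun m _ => ?_
      rw [h2, h1, fourierCoeff_congr_ae hmem.coeFn_toLp, fourierCoeff_delayResponse, smul_eq_mul]
    have h4 := ae_all_iff.2 fun k => hterm (Finset.Icc (-(φ k : ℤ)) (φ k))
    filter_upwards [hae, h4, hmem.coeFn_toLp] with s h1 h2 h3
    rw [h3] at h1
    refine h1.congr fun k => ?_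
    exact h2 k
  have hae2 : ∀ᵐ s ∂(volume : Measure UnitAddCircle), Tendsto (fun k =>
      ∑ m ∈ Finset.Icc (-(φ k : ℤ)) (φ k), (Real.sinc (Real.pi * (m + α)) : ℂ) * fourier m s)
      atTop (𝓝 (delayResponse α s)) := by
    rw [AddCircle.volume_eq_smul_haarAddCircle]
    exact Measure.ae_smul_measure hae1 _
  filter_upwards [ae_unitAddCircle_coe hae2] with s hs
  rw [delayResponse_coe] at hs
  refine hs.congr fun k => ?_
  -- reflect `m ↦ -m`
  refine Finset.sum_bij' (fun m _ => -m) (fun m _ => -m) ?_ ?_ ?_ ?_ ?_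
  · intro m hm; rw [Finset.mem_Icc] at hm ⊢; omega
  · intro m hm; rw [Finset.mem_Icc] at hm ⊢; omega
  · intro m _; simp
  · intro m _; simp
  · intro m _
    rw [fourier_coe_apply, ← Real.sinc_neg]
    congr 2
    · push_cast; ring_nf
    · push_cast; ring_nf

end DelayFilter

/-! ### The fractionally delayed channels -/

section Channels

/-- A mean square limit of centred Gaussian variables is centred Gaussian: the variances, and hence
the characteristic functions, converge. -/
theorem map_eq_gaussianReal_of_tendsto_eLpNorm {Ω : Type*} [MeasurableSpace Ω] {μ : Measure Ω}
    [IsProbabilityMeasure μ] {Y : ℕ → Ω → ℝ} {Z : Ω → ℝ} (hY : ∀ M, HasGaussianLaw (Y M) μ)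
    (h0 : ∀ M, ∫ ω, Y M ω ∂μ = 0) (hZ : MemLp Z 2 μ)
    (hlim : Tendsto (fun M => eLpNorm (Y M - Z) 2 μ) atTop (𝓝 0)) :
    μ.map Z = gaussianReal 0 (∫ ω, Z ω * Z ω ∂μ).toNNReal := by
  have hYL := fun M => (hY M).memLp_two
  have hvar : Tendsto (fun M => ∫ ω, Y M ω * Y M ω ∂μ) atTop (𝓝 (∫ ω, Z ω * Z ω ∂μ)) := by
    simpa only [Real.inner_apply] using
      tendsto_integral_inner_of_tendsto_eLpNorm hYL hZ hYL hZ hlim hlim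
  have hdist := (tendstoInMeasure_of_tendsto_eLpNorm (by norm_num)
    (fun M => (hYL M).1) hZ.1 hlim).tendstoInDistribution (fun M => (hYL M).1.aemeasurable)
  have := Measure.isProbabilityMeasure_map (μ := μ) hZ.1.aemeasurable
  refine Measure.ext_of_charFun (funext fun t => ?_)
  have h1 := ProbabilityMeasure.tendsto_iff_tendsto_charFun.1 hdist.tendsto t
  simp only [ProbabilityMeasure.coe_mk] at h1
  have h2 : ∀ M, charFun (μ.map (Y M)) t =
      Complex.exp (-(((∫ ω, Y M ω * Y M ω ∂μ : ℝ) : ℂ) * t ^ 2 / 2)) := by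
    intro M
    have hv : variance (Y M) μ = ∫ ω, Y M ω * Y M ω ∂μ := by
      rw [variance_eq_integral (hYL M).1.aemeasurable, h0]
      simp only [sub_zero, sq]
    rw [(hY M).map_eq_gaussianReal, charFun_gaussianReal, Real.coe_toNNReal _ (variance_nonneg _ _),
      hv, h0]
    simp
  simp_rw [h2] at h1
  have h3 : Tendsto (fun M => Complex.exp (-(((∫ ω, Y M ω * Y M ω ∂μ : ℝ) : ℂ) * t ^ 2 / 2))) atTop
      (𝓝 (Complex.exp (-(((∫ ω, Z ω * Z ω ∂μ : ℝ) : ℂ) * t ^ 2 / 2)))) := by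
    have hc : Continuous fun r : ℝ => Complex.exp (-((r : ℂ) * t ^ 2 / 2)) := by fun_prop
    exact (hc.tendsto _).comp hvar
  rw [tendsto_nhds_unique h1 h3, charFun_gaussianReal, Real.coe_toNNReal _
    (integral_nonneg fun ω => mul_self_nonneg _)]
  simp

variable {Ω : Type*} [MeasurableSpace Ω] {μ : Measure Ω} {x : ℝ → Ω → ℝ} {P : ℝ → ℝ} {W : ℝ}
  {q L : ℕ} {c : Fin q → ℕ} {z : Fin q → ℤ → Ω → ℝ}

/-- The sampling instant of `y_i(n - m)`. -/
noncomputable def channelTime (W : ℝ) (L : ℕ) (c : Fin q → ℕ) (i : Fin q) (n m : ℤ) : ℝ :=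
  (((n - m : ℤ) : ℝ) * L + c i) / W

/-- The subband of width `2πW/L`, centred at a multiple of its width, that contains the frequency
`w`. -/
noncomputable def bandOf (W : ℝ) (L : ℕ) (w : ℝ) : ℤ := round (w * (L / (2 * Real.pi * W)))

/-- Spectral representative of `z_i(n)`: the fractional delay undoes the delay of the channel
except for a phase which depends on the subband only. -/
noncomputable def channelPhase (W : ℝ) (L : ℕ) (c : Fin q → ℕ) (i : Fin q) (n : ℤ) (w : ℝ) : ℂ :=
  Complex.exp (Complex.I * w * (n * L / W)) *
    Complex.exp (2 * Real.pi * Complex.I * (c i / L) * bandOf W L w)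

theorem measurable_bandOf (W : ℝ) (L : ℕ) : Measurable (bandOf W L) := by
  have h : bandOf W L = fun w => ⌊w * (L / (2 * Real.pi * W)) + 1 / 2⌋ := by
    funext w
    rw [bandOf, round_eq]
  rw [h]
  fun_prop

theorem memLp_channelPhase (hi : Integrable P) (i : Fin q) (n : ℤ) :
    MemLp (channelPhase W L c i n) 2 (specMeasure P) := by
  have := isFiniteMeasure_specMeasure hi
  refine MemLp.of_bound (Measurable.aestronglyMeasurable ?_) 1 (ae_of_all _ fun w => ?_)
  · have h : Measurable fun w => ((bandOf W L w : ℤ) : ℂ) :=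
      (measurable_of_countable fun k : ℤ => (k : ℂ)).comp (measurable_bandOf W L)
    unfold channelPhase
    fun_prop
  · have h1 : Complex.I * w * (n * L / W) = ((w * (n * L / W) : ℝ) : ℂ) * Complex.I := by
      push_cast; ring
    have h2 : 2 * Real.pi * Complex.I * (c i / L) * bandOf W L w =
        ((2 * Real.pi * (c i / L) * bandOf W L w : ℝ) : ℂ) * Complex.I := by
      push_cast; ring
    rw [channelPhase, norm_mul, h1, h2, Complex.norm_exp_ofReal_mul_I,
      Complex.norm_exp_ofReal_mul_I, one_mul]

theorem tendsto_sampleSum_sub (hdelay : ∀ i, IsFiltered μ (delayFilter L c i)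
      (cosetSample x W L c i) (z i)) (i : Fin q) (n : ℤ) :
    Tendsto (fun M : ℕ => eLpNorm (sampleSum x (Finset.Icc (-(M : ℤ)) M) (delayFilter L c i)
      (channelTime W L c i n) - z i n) 2 μ) atTop (𝓝 0) := by
  refine (hdelay i n).2.congr fun M => ?_
  rw [eLpNorm_sub_comm]
  rfl

/-- The spectral representatives of the partial sums which define `z_i(n)` converge almost
everywhere along a subsequence; this is `exists_subseq_tendsto_sinc_sum` at the delay `c_i / L`,
with the frequency rescaled by the sampling period `L / W`. -/
theorem exists_subseq_tendsto_expSum (hW : 0 < W) (hL0 : 0 < L) (i : Fin q) (n : ℤ) :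
    ∃ φ : ℕ → ℕ, StrictMono φ ∧ ∀ᵐ w : ℝ, Tendsto (fun k =>
      expSum (Finset.Icc (-(φ k : ℤ)) (φ k)) (delayFilter L c i) (channelTime W L c i n) w) atTop
      (𝓝 (channelPhase W L c i n w)) := by
  obtain ⟨φ, hφ, hae⟩ := exists_subseq_tendsto_sinc_sum ((c i : ℝ) / L)
  refine ⟨φ, hφ, ?_⟩
  have hL' : (L : ℝ) ≠ 0 := by exact_mod_cast hL0.ne'
  have hr : (L : ℝ) / (2 * Real.pi * W) ≠ 0 := by
    have := Real.pi_pos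
    positivity
  have hqmp : Measure.QuasiMeasurePreserving
      (fun w : ℝ => w * (L / (2 * Real.pi * W))) volume volume := by
    refine ⟨by fun_prop, ?_⟩
    rw [Real.map_volume_mul_right hr]
    exact Measure.smul_absolutelyContinuous
  filter_upwards [hqmp.ae hae] with w hw
  have hLc : (L : ℂ) ≠ 0 := by exact_mod_cast hL0.ne'
  have hWc : (W : ℂ) ≠ 0 := by exact_mod_cast hW.ne'
  have hpic : (Real.pi : ℂ) ≠ 0 := by exact_mod_cast Real.pi_ne_zero
  have h1 := hw.const_mul (Complex.exp (Complex.I * w * ((n * L + c i) / W)))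
  have e : Complex.exp (Complex.I * w * ((n * L + c i) / W)) *
      Complex.exp (-(2 * Real.pi * ((c i : ℝ) / L) * (w * (L / (2 * Real.pi * W)) -
        round (w * (L / (2 * Real.pi * W)))) : ℝ) * Complex.I) = channelPhase W L c i n w := by
    rw [channelPhase, ← Complex.exp_add, ← Complex.exp_add, bandOf]
    congr 1
    push_cast
    field_simp
    ring
  rw [e] at h1
  refine h1.congr fun k => ?_
  rw [expSum, Finset.mul_sum]
  refine Finset.sum_congr rfl fun m _ => ?_
  rw [mul_left_comm, ← Complex.exp_add, delayFilter, channelTime]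
  congr 2
  push_cast
  field_simp
  ring

/-- The correlations of the filtered channels in terms of the power spectral density; they do not
depend on `n`. -/
theorem integral_channel_mul_channel (hW : 0 < W) (hL0 : 0 < L) (hx : IsGaussianWSS x μ)
    (hP : IsPowerSpectralDensity (autocorr x μ) P)
    (hdelay : ∀ i, IsFiltered μ (delayFilter L c i) (cosetSample x W L c i) (z i))
    (a b : Fin q) (n : ℤ) :
    ((∫ ω, z a n ω * z b n ω ∂μ : ℝ) : ℂ) = (1 / (2 * Real.pi) : ℂ) * ∫ w, (P w : ℂ) *
      Complex.exp (2 * Real.pi * Complex.I * (((c a : ℂ) - c b) / L) * bandOf W L w) := by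
  have hl : ∀ i, Tendsto (fun M : ℕ => eLpNorm (expSum (Finset.Icc (-(M : ℤ)) M) (delayFilter L c i)
      (channelTime W L c i n) - channelPhase W L c i n) 2 (specMeasure P)) atTop (𝓝 0) := by
    intro i
    obtain ⟨φ, hφ, hae⟩ := exists_subseq_tendsto_expSum (c := c) hW hL0 i n
    exact tendsto_eLpNorm_expSum_sub hx hP (S := fun M : ℕ => Finset.Icc (-(M : ℤ)) M)
      (hdelay i n).1 (tendsto_sampleSum_sub hdelay i n) hφ hae
  have h1 := tendsto_integral_inner_of_tendsto_eLpNorm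
    (fun M => memLp_expSum hP.integrable (Finset.Icc (-(M : ℤ)) M) (delayFilter L c b)
      (channelTime W L c b n) 2) (memLp_channelPhase hP.integrable b n)
    (fun M => memLp_expSum hP.integrable (Finset.Icc (-(M : ℤ)) M) (delayFilter L c a)
      (channelTime W L c a n) 2) (memLp_channelPhase hP.integrable a n) (hl b) (hl a)
  have h2 := tendsto_integral_inner_of_tendsto_eLpNorm
    (fun M => memLp_sampleSum hx (Finset.Icc (-(M : ℤ)) M) (delayFilter L c a)
      (channelTime W L c a n)) (hdelay a n).1
    (fun M => memLp_sampleSum hx (Finset.Icc (-(M : ℤ)) M) (delayFilter L c b)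
      (channelTime W L c b n)) (hdelay b n).1
    (tendsto_sampleSum_sub hdelay a n) (tendsto_sampleSum_sub hdelay b n)
  simp only [Real.inner_apply] at h2
  have h3 := (Complex.continuous_ofReal.tendsto _).comp h2
  simp only [Function.comp_def, integral_sampleSum_mul_sampleSum hx hP] at h3
  rw [tendsto_nhds_unique h3 (h1.const_mul _), integral_specMeasure hP.integrable hP.nonneg]
  congr 2
  funext w
  congr 1
  rw [RCLike.inner_apply, channelPhase, channelPhase, map_mul, ← Complex.exp_conj,
    ← Complex.exp_conj, ← Complex.exp_add, ← Complex.exp_add, ← Complex.exp_add]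
  congr 1
  simp only [map_mul, map_div₀, Complex.conj_I, Complex.conj_ofReal, map_intCast, map_natCast,
    map_ofNat]
  ring

/-- Each linear functional of a snapshot is a mean square limit of linear combinations of samples of
the Gaussian process, and its variance is determined by the correlation matrix. -/
theorem snapshot_map_eq_gaussLaw [IsProbabilityMeasure μ] (hW : 0 < W) (hL0 : 0 < L)
    (hx : IsGaussianWSS x μ) (hP : IsPowerSpectralDensity (autocorr x μ) P)
    (hz : ∀ i n, Measurable (z i n))
    (hdelay : ∀ i, IsFiltered μ (delayFilter L c i) (cosetSample x W L c i) (z i))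
    (hR : (corrMatrix z μ).PosDef) (n : ℕ) :
    μ.map (snapshot z n) = gaussLaw (corrMatrix z μ) := by
  have hm : Measurable (snapshot z n) := measurable_pi_lambda _ fun i => hz i n
  have := Measure.isProbabilityMeasure_map (μ := μ) hm.aemeasurable
  refine eq_gaussLaw_of_map_dotProduct hR fun v => ?_
  rw [Measure.map_map (by fun_prop) hm]
  let t : Fin q × ℤ → ℝ := fun p => channelTime W L c p.1 n p.2
  let a : Fin q × ℤ → ℝ := fun p => v p.1 * delayFilter L c p.1 p.2
  let S : ℕ → Finset (Fin q × ℤ) := fun M => Finset.univ ×ˢ Finset.Icc (-(M : ℤ)) M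
  have hzL : MemLp (fun ω => v ⬝ᵥ snapshot z n ω) 2 μ :=
    memLp_finsetSum _ fun i _ => (hdelay i n).1.const_mul _
  have hgauss : ∀ M, HasGaussianLaw (sampleSum x (S M) a t) μ := by
    intro M
    exact ((hx.gaussian.comp_right t).smul a).hasGaussianLaw_fun_sum
  have hmean : ∀ M, ∫ ω, sampleSum x (S M) a t ω ∂μ = 0 := by
    intro M
    simp only [sampleSum]
    rw [integral_finsetSum _ fun p _ =>
      (hx.gaussian.hasGaussianLaw_eval (t p)).integrable.const_mul _]
    simp [integral_const_mul, hx.zero_mean]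
  have hlim : Tendsto (fun M => eLpNorm (sampleSum x (S M) a t - fun ω => v ⬝ᵥ snapshot z n ω) 2 μ)
      atTop (𝓝 0) := by
    have hsub : ∀ M, (sampleSum x (S M) a t - fun ω => v ⬝ᵥ snapshot z n ω) =
        ∑ i, v i • (sampleSum x (Finset.Icc (-(M : ℤ)) M) (delayFilter L c i)
          (channelTime W L c i n) - z i n) := by
      intro M
      funext ω
      simp only [Pi.sub_apply, Finset.sum_apply, Pi.smul_apply, smul_eq_mul, sampleSum, S, a, t,
        Finset.sum_product, mul_sub, Finset.sum_sub_distrib, dotProduct, snapshot, Finset.mul_sum,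
        mul_assoc]
    have hb : Tendsto (fun M : ℕ => ∑ i, ‖v i‖ₑ * eLpNorm (sampleSum x (Finset.Icc (-(M : ℤ)) M)
        (delayFilter L c i) (channelTime W L c i n) - z i n) 2 μ) atTop (𝓝 0) := by
      have := tendsto_finsetSum (Finset.univ : Finset (Fin q)) fun i _ =>
        ENNReal.Tendsto.const_mul (a := ‖v i‖ₑ) (tendsto_sampleSum_sub hdelay i n)
          (Or.inr enorm_ne_top)
      simpa using this
    refine tendsto_of_tendsto_of_tendsto_of_le_of_le tendsto_const_nhds hb (fun _ => zero_le)
      fun M => ?_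
    simp only [hsub]
    refine (eLpNorm_sum_le (fun i _ => ?_) (by norm_num)).trans (Finset.sum_le_sum fun i _ => ?_)
    · exact ((memLp_sampleSum hx _ _ _).sub (hdelay i n).1).1.const_smul _
    · rw [eLpNorm_const_smul]
  have hvar : ∫ ω, (v ⬝ᵥ snapshot z n ω) * (v ⬝ᵥ snapshot z n ω) ∂μ =
      v ⬝ᵥ (corrMatrix z μ).mulVec v := by
    have hc : corrMatrix z μ = Matrix.of fun i j => ∫ ω, z i n ω * z j n ω ∂μ := by
      ext i j
      rw [corrMatrix, of_apply, of_apply]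
      have h1 := integral_channel_mul_channel hW hL0 hx hP hdelay i j 0
      have h2 := integral_channel_mul_channel hW hL0 hx hP hdelay i j n
      exact_mod_cast h1.trans h2.symm
    rw [hc, dotProduct_gram_mulVec fun i => (hdelay i n).1]
    simp only [sq, dotProduct, snapshot]
  have h := map_eq_gaussianReal_of_tendsto_eLpNorm hgauss hmean hzL hlim
  rw [hvar] at h
  exact h

end Channels

/-! ### Subbands and the linear system `u = Ψ v` -/

section Bands

variable {P : ℝ → ℝ} {W : ℝ} {L : ℕ}

theorem bandOf_eq_iff (hW : 0 < W) (hL0 : 0 < L) (w : ℝ) (m : ℤ) :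
    bandOf W L w = -m ↔ w ∈ Set.Ico (-(Real.pi * W / L) - 2 * Real.pi * W / L * m)
      (Real.pi * W / L - 2 * Real.pi * W / L * m) := by
  have hL' : (0 : ℝ) < L := by exact_mod_cast hL0
  have hpi := Real.pi_pos
  have hD : 0 < 2 * Real.pi * W := by positivity
  rw [bandOf, round_eq_iff, Set.mem_Ico, Set.mem_Ico, ← mul_div_assoc, div_lt_iff₀ hD,
    le_div_iff₀ hD]
  have e1 : -(Real.pi * W / L) - 2 * Real.pi * W / L * m =
      (((-m : ℤ) : ℝ) - 1 / 2) * (2 * Real.pi * W) / L := by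
    push_cast; field_simp; ring
  have e2 : Real.pi * W / L - 2 * Real.pi * W / L * m =
      (((-m : ℤ) : ℝ) + 1 / 2) * (2 * Real.pi * W) / L := by
    push_cast; field_simp; ring
  rw [e1, e2, div_le_iff₀ hL', lt_div_iff₀ hL']

/-- The power in subband `m` is defined by the shift `w ↦ w - 2πWm/L`, so it belongs to the
frequencies around `-2πWm/L`. -/
theorem setIntegral_bandOf (hW : 0 < W) (hL0 : 0 < L) (m : ℤ) :
    ∫ w in {w | bandOf W L w = -m}, P w = 2 * Real.pi * subbandPower P W L m := by
  have hL' : (0 : ℝ) < L := by exact_mod_cast hL0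
  have hpi := Real.pi_pos
  have hB : 0 < Real.pi * W / L := by positivity
  have hset : {w | bandOf W L w = -m} = Set.Ico (-(Real.pi * W / L) - 2 * Real.pi * W / L * m)
      (Real.pi * W / L - 2 * Real.pi * W / L * m) :=
    Set.ext fun w => bandOf_eq_iff hW hL0 w m
  rw [hset, integral_Ico_eq_integral_Ioc, ← intervalIntegral.integral_of_le (by linarith),
    subbandPower, intervalIntegral.integral_comp_sub_right (fun w => P w)]
  field_simp

theorem bandOf_mem_Icc (hW : 0 < W) (hL : Even L) (hL0 : 0 < L) {w : ℝ}
    (hw : |w| ≤ Real.pi * W) : bandOf W L w ∈ Finset.Icc (-((L / 2 : ℕ) : ℤ)) (L / 2 : ℕ) := by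
  obtain ⟨H, rfl⟩ := hL
  have hH : (H + H) / 2 = H := by omega
  have hpi := Real.pi_pos
  rw [hH]
  set s := w * (((H + H : ℕ) : ℝ) / (2 * Real.pi * W)) with hs
  have hsb : |s| ≤ H := by
    rw [hs, abs_mul, abs_of_nonneg (a := ((H + H : ℕ) : ℝ) / (2 * Real.pi * W)) (by positivity)]
    calc |w| * (((H + H : ℕ) : ℝ) / (2 * Real.pi * W))
        ≤ Real.pi * W * (((H + H : ℕ) : ℝ) / (2 * Real.pi * W)) := by gcongr
      _ = H := by push_cast; field_simp; ring
  have hr := abs_le.1 (abs_sub_round s)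
  have hb := abs_le.1 hsb
  have h1 : ((round s : ℤ) : ℝ) < ((H : ℤ) : ℝ) + 1 := by push_cast; linarith [hr.1, hb.2]
  have h2 : -((H : ℤ) : ℝ) - 1 < ((round s : ℤ) : ℝ) := by push_cast; linarith [hr.2, hb.1]
  have h1' : round s < (H : ℤ) + 1 := by exact_mod_cast h1
  have h2' : -(H : ℤ) - 1 < round s := by exact_mod_cast h2
  rw [bandOf, ← hs, Finset.mem_Icc]
  omega

/-- Splitting of the frequency axis into the subbands. -/
theorem integral_bandOf (hi : Integrable P) (hband : IsBandLimited P W) (hW : 0 < W) (hL : Even L)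
    (hL0 : 0 < L) (e : ℤ → ℂ) :
    ∫ w, (P w : ℂ) * e (bandOf W L w) = 2 * Real.pi *
      ∑ m ∈ Finset.Icc (-((L / 2 : ℕ) : ℤ)) (L / 2 : ℕ), e (-m) * (subbandPower P W L m : ℂ) := by
  set H : ℤ := ((L / 2 : ℕ) : ℤ) with hH
  have hmeas : ∀ m : ℤ, MeasurableSet {w | bandOf W L w = m} := fun m =>
    measurable_bandOf W L (measurableSet_singleton m)
  have hpt : ∀ w, (P w : ℂ) * e (bandOf W L w) = ∑ m ∈ Finset.Icc (-H) H,
      {w | bandOf W L w = -m}.indicator (fun w => e (-m) * (P w : ℂ)) w := by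
    intro w
    by_cases hw : |w| ≤ Real.pi * W
    · have hmem := bandOf_mem_Icc hW hL hL0 hw
      rw [Finset.mem_Icc] at hmem
      rw [Finset.sum_eq_single (-bandOf W L w)]
      · rw [Set.indicator_of_mem (by simp), neg_neg, mul_comm]
      · intro m _ hm
        refine Set.indicator_of_notMem (fun h => hm ?_) _
        have : bandOf W L w = -m := h
        omega
      · intro h
        exact absurd (Finset.mem_Icc.2 (by omega)) h
    · have h0 : P w = 0 := hband w (not_le.1 hw)
      rw [h0, Complex.ofReal_zero, zero_mul]
      refine (Finset.sum_eq_zero fun m _ => ?_).symm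
      by_cases hm : w ∈ {w | bandOf W L w = -m}
      · rw [Set.indicator_of_mem hm, h0]
        simp
      · rw [Set.indicator_of_notMem hm]
  simp_rw [hpt]
  rw [integral_finsetSum _ fun m _ => (hi.ofReal.const_mul _).indicator (hmeas _), Finset.mul_sum]
  refine Finset.sum_congr rfl fun m _ => ?_
  rw [integral_indicator (hmeas _), integral_const_mul, integral_complex_ofReal,
    setIntegral_bandOf hW hL0]
  push_cast
  ring

/-- The sum over the subbands `-L/2, …, L/2`, whose two extreme members are the halves of one
subband modulo the sampling rate, in terms of the vector of subband powers. -/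
theorem sum_subband_eq (hL : Even L) (hL0 : 0 < L) (e : ℤ → ℂ)
    (he : e (-((L / 2 : ℕ) : ℤ)) = e ((L / 2 : ℕ) : ℤ)) :
    ∑ m ∈ Finset.Icc (-((L / 2 : ℕ) : ℤ)) (L / 2 : ℕ), e m * (subbandPower P W L m : ℂ) =
      ∑ l : Fin L, e (subbandIdx L l) * (powerVec P W L l : ℂ) := by
  set H : ℤ := ((L / 2 : ℕ) : ℤ) with hH
  have hLH : (L : ℤ) = 2 * H := by
    obtain ⟨k, rfl⟩ := hL
    omega
  have hH0 : 0 < H := by omega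
  have hterm : ∀ l : Fin L, e (subbandIdx L l) * (powerVec P W L l : ℂ) =
      (fun m : ℤ => e m * (subbandPower P W L m : ℂ) +
        if m = H then e m * (subbandPower P W L (-m) : ℂ) else 0) (subbandIdx L l) := by
    intro l
    simp only [powerVec, ← hH]
    split_ifs
    · push_cast; ring
    · ring
  have hbij : ∀ f : ℤ → ℂ, ∑ l : Fin L, f (subbandIdx L l) = ∑ m ∈ Finset.Ioc (-H) H, f m := by
    intro f
    refine Finset.sum_bij' (fun l _ => subbandIdx L l)
      (fun m hm => ⟨(m + H - 1).toNat, by rw [Finset.mem_Ioc] at hm; omega⟩) ?_ ?_ ?_ ?_ ?_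
    · intro l _
      have := l.2
      rw [Finset.mem_Ioc, subbandIdx]
      omega
    · intro m hm; exact Finset.mem_univ _
    · intro l _
      ext
      simp only [subbandIdx]
      omega
    · intro m hm
      rw [Finset.mem_Ioc] at hm
      simp only [subbandIdx]
      omega
    · intro l _; rfl
  rw [Finset.sum_congr rfl fun l _ => hterm l, hbij fun m => e m * (subbandPower P W L m : ℂ) +
    if m = H then e m * (subbandPower P W L (-m) : ℂ) else 0]
  have hIcc : Finset.Icc (-H) H = insert (-H) (Finset.Ioc (-H) H) := by
    ext m
    simp only [Finset.mem_insert, Finset.mem_Icc, Finset.mem_Ioc]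
    omega
  rw [hIcc, Finset.sum_insert (by simp), Finset.sum_add_distrib, Finset.sum_ite_eq',
    if_pos (Finset.mem_Ioc.2 (by omega)), he]
  ring

end Bands

section System

variable {Ω : Type*} [MeasurableSpace Ω] {μ : Measure Ω} {x : ℝ → Ω → ℝ} {P : ℝ → ℝ} {W : ℝ}
  {q L : ℕ} {c : Fin q → ℕ} {z : Fin q → ℤ → Ω → ℝ}

/-- The linear system `u = Ψ v` between the correlations of the channels and the subband powers. -/
theorem corrVec_corrMatrix (hW : 0 < W) (hL : Even L) (hL0 : 0 < L) (hx : IsGaussianWSS x μ)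
    (hP : IsPowerSpectralDensity (autocorr x μ) P) (hband : IsBandLimited P W)
    (hdelay : ∀ i, IsFiltered μ (delayFilter L c i) (cosetSample x W L c i) (z i)) (a₀ : Fin q) :
    corrVec a₀ (corrMatrix z μ) =
      (Psi L c a₀).mulVec (fun l => (powerVec P W L l : ℂ)) := by
  funext i
  set a := (chanPair a₀ i).1 with ha
  set b := (chanPair a₀ i).2 with hb
  let e : ℤ → ℂ := fun m => Complex.exp (-Complex.I * (2 * Real.pi / L) * ((c a : ℂ) - c b) * m)
  have hLc : (L : ℂ) ≠ 0 := by exact_mod_cast hL0.ne'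
  have hpic : (2 * Real.pi : ℂ) ≠ 0 := by simp
  have he : e (-((L / 2 : ℕ) : ℤ)) = e ((L / 2 : ℕ) : ℤ) := by
    -- the two exponents differ by `2πj (c a - c b)`
    have h2 : (((L / 2 : ℕ) : ℤ) : ℂ) * 2 = L := by
      obtain ⟨k, rfl⟩ := hL
      have : (k + k) / 2 = k := by omega
      rw [this]
      push_cast
      ring
    simp only [e]
    rw [Complex.exp_eq_exp_iff_exists_int]
    refine ⟨(c a : ℤ) - c b, ?_⟩
    have h3 : (((L / 2 : ℕ) : ℤ) : ℂ) = L / 2 := by rw [← h2]; ring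
    rw [Int.cast_neg, h3]
    push_cast
    field_simp
    ring
  have h1 : corrVec a₀ (corrMatrix z μ) i = ((∫ ω, z a 0 ω * z b 0 ω ∂μ : ℝ) : ℂ) := rfl
  have h2 : ∀ w, (P w : ℂ) *
      Complex.exp (2 * Real.pi * Complex.I * (((c a : ℂ) - c b) / L) * bandOf W L w) =
      (P w : ℂ) * (fun m => e (-m)) (bandOf W L w) := by
    intro w
    simp only [e]
    congr 2
    push_cast
    field_simp
  rw [h1, integral_channel_mul_channel hW hL0 hx hP hdelay, integral_congr_ae (ae_of_all _ h2),
    integral_bandOf hP.integrable hband hW hL hL0 fun m => e (-m)]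
  simp only [neg_neg]
  rw [sum_subband_eq hL hL0 e he, ← mul_assoc, one_div, inv_mul_cancel₀ hpic, one_mul]
  rfl

theorem PsiTilde_mulVec (a₀ : Fin q) (v : Fin L → ℝ) :
    (PsiTilde L c a₀).mulVec v = stack ((Psi L c a₀).mulVec fun l => (v l : ℂ)) := by
  funext i
  rcases i with i | i <;>
    simp [PsiTilde, stack, mulVec, dotProduct]

theorem isUnit_of_rank_eq {K : Type*} [Field K] (A : Matrix (Fin L) (Fin L) K)
    (h : A.rank = L) : IsUnit A := by
  rw [← mulVec_surjective_iff_isUnit]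
  have : LinearMap.range A.mulVecLin = ⊤ :=
    Submodule.eq_top_of_finrank_eq (by rw [← Matrix.rank, h]; simp)
  exact LinearMap.range_eq_top.1 this

/-- Full column rank makes the normal equations uniquely solvable. -/
theorem noncompressive_of_corrVec_eq {a₀ : Fin q} (hrank : (PsiTilde L c a₀).rank = L)
    {R : Matrix (Fin q) (Fin q) ℝ} {v : EuclideanSpace ℝ (Fin L)}
    (h : corrVec a₀ R = (Psi L c a₀).mulVec fun l => (v l : ℂ)) : noncompressive L c a₀ R = v := by
  have hu : IsUnit ((PsiTilde L c a₀).transpose * PsiTilde L c a₀).det := by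
    rw [← isUnit_iff_isUnit_det]
    refine isUnit_of_rank_eq _ ?_
    rw [rank_transpose_mul_self, hrank]
  rw [noncompressive, h, ← PsiTilde_mulVec, mulVec_mulVec, Matrix.mul_assoc, nonsing_inv_mul _ hu,
    one_mulVec]

open scoped ComplexOrder in
theorem noncompressiveC_of_corrVec_eq {a₀ : Fin q} (hrank : (Psi L c a₀).rank = L)
    {R : Matrix (Fin q) (Fin q) ℝ} {v : Fin L → ℂ}
    (h : corrVec a₀ R = (Psi L c a₀).mulVec v) : noncompressiveC L c a₀ R = v := by
  have hu : IsUnit ((Psi L c a₀).conjTranspose * Psi L c a₀).det := by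
    rw [← isUnit_iff_isUnit_det]
    refine isUnit_of_rank_eq _ ?_
    rw [rank_conjTranspose_mul_self, hrank]
  rw [noncompressiveC, h, mulVec_mulVec, Matrix.mul_assoc, nonsing_inv_mul _ hu, one_mulVec]

theorem corrVec_add (a₀ : Fin q) (R S : Matrix (Fin q) (Fin q) ℝ) :
    corrVec a₀ (R + S) = corrVec a₀ R + corrVec a₀ S := by
  funext i
  simp [corrVec]

theorem corrVec_smul (a₀ : Fin q) (t : ℝ) (R : Matrix (Fin q) (Fin q) ℝ) :
    corrVec a₀ (t • R) = (t : ℂ) • corrVec a₀ R := by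
  funext i
  simp [corrVec]

theorem stack_add {κ : Type*} (u v : κ → ℂ) : stack (u + v) = stack u + stack v := by
  funext i
  rcases i with i | i <;> simp [stack]

theorem stack_smul {κ : Type*} (t : ℝ) (u : κ → ℂ) : stack ((t : ℂ) • u) = t • stack u := by
  funext i
  rcases i with i | i <;> simp [stack]

theorem isLinearMap_noncompressive (a₀ : Fin q) : IsLinearMap ℝ (noncompressive L c a₀) where
  map_add R S := by
    simp only [noncompressive, corrVec_add, stack_add, mulVec_add, WithLp.toLp_add]
  map_smul t R := by
    simp only [noncompressive, corrVec_smul, stack_smul, mulVec_smul, WithLp.toLp_smul]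

theorem isLinearMap_stack_noncompressiveC (a₀ : Fin q) :
    IsLinearMap ℝ fun R => (WithLp.toLp 2 (stack (noncompressiveC L c a₀ R)) :
      EuclideanSpace ℝ (Fin L ⊕ Fin L)) where
  map_add R S := by
    simp only [noncompressiveC, corrVec_add, stack_add, mulVec_add, WithLp.toLp_add]
  map_smul t R := by
    simp only [noncompressiveC, corrVec_smul, stack_smul, mulVec_smul, WithLp.toLp_smul]

end System

end MultiCoset

theorem mainTheorem2 {Ω : Type*} [MeasurableSpace Ω] (μ : Measure Ω) [IsProbabilityMeasure μ]
    -- the process and its power spectral density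
    (x : ℝ → Ω → ℝ) (P : ℝ → ℝ) (W : ℝ) (hW : 0 < W)
    (hx : MultiCoset.IsGaussianWSS x μ)
    (hP : MultiCoset.IsPowerSpectralDensity (MultiCoset.autocorr x μ) P)
    (hband : MultiCoset.IsBandLimited P W)
    -- the sampling pattern
    (q L : ℕ) (hL : Even L) (hL0 : 0 < L) (c : Fin q → ℕ)
    (hc : Function.Injective c) (hcL : ∀ i, c i < L) (a₀ : Fin q)
    -- the fractionally delayed channel outputs
    (z : Fin q → ℤ → Ω → ℝ) (hz : ∀ i n, Measurable (z i n))
    (hdelay : ∀ i, MultiCoset.IsFiltered μ (MultiCoset.delayFilter L c i)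
      (MultiCoset.cosetSample x W L c i) (z i))
    -- independent snapshots with nonsingular correlation matrix
    (hindep : iIndepFun (fun n : ℕ => MultiCoset.snapshot z n) μ)
    (hR : (MultiCoset.corrMatrix z μ).PosDef)
    -- the noncompressive solution is unique
    (hrank : (MultiCoset.PsiTilde L c a₀).rank = L) :
    -- every snapshot is Gaussian with correlation matrix `R`
    (∀ n : ℕ, μ.map (MultiCoset.snapshot z n) =
      MultiCoset.gaussLaw (MultiCoset.corrMatrix z μ)) ∧
    -- `u = Ψ v`, and `v` is the noncompressive solution for `R`
    MultiCoset.corrVec a₀ (MultiCoset.corrMatrix z μ) =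
      (MultiCoset.Psi L c a₀).mulVec (fun l => (MultiCoset.powerVec P W L l : ℂ)) ∧
    MultiCoset.noncompressive L c a₀ (MultiCoset.corrMatrix z μ) = MultiCoset.powerVec P W L ∧
    -- `S` is the MLE of `R`, and `û` and `v̂_NC` are MLEs of `u` and `v`
    (∀ᵐ ω ∂μ, ∀ N : ℕ, q ≤ N →
      MultiCoset.IsMLE (MultiCoset.logLik N (fun n => MultiCoset.snapshot z n ω))
        (MultiCoset.sampleCorr z N ω) ∧
      (∀ R' : Matrix (Fin q) (Fin q) ℝ,
        MultiCoset.IsMLE (MultiCoset.logLik N (fun n => MultiCoset.snapshot z n ω)) R' →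
          R' = MultiCoset.sampleCorr z N ω) ∧
      MultiCoset.IsMLEOf (MultiCoset.logLik N (fun n => MultiCoset.snapshot z n ω))
        (MultiCoset.corrVec a₀) (MultiCoset.corrVec a₀ (MultiCoset.sampleCorr z N ω)) ∧
      MultiCoset.IsMLEOf (MultiCoset.logLik N (fun n => MultiCoset.snapshot z n ω))
        (MultiCoset.noncompressive L c a₀)
        (MultiCoset.noncompressive L c a₀ (MultiCoset.sampleCorr z N ω))) ∧
    -- `v̂_NC` is asymptotically efficient
    MultiCoset.IsAsymptoticallyEfficient μ
      (fun N ω => MultiCoset.noncompressive L c a₀ (MultiCoset.sampleCorr z N ω))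
      (MultiCoset.noncompressive L c a₀) (MultiCoset.corrMatrix z μ) ∧
    -- the same for the form `Ψ† û` when `Ψ` has full column rank over `ℂ`
    ((MultiCoset.Psi L c a₀).rank = L →
      MultiCoset.noncompressiveC L c a₀ (MultiCoset.corrMatrix z μ) =
        (fun l => (MultiCoset.powerVec P W L l : ℂ)) ∧
      (∀ᵐ ω ∂μ, ∀ N : ℕ, q ≤ N →
        MultiCoset.IsMLEOf (MultiCoset.logLik N (fun n => MultiCoset.snapshot z n ω))
          (MultiCoset.noncompressiveC L c a₀)
          (MultiCoset.noncompressiveC L c a₀ (MultiCoset.sampleCorr z N ω))) ∧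
      MultiCoset.IsAsymptoticallyEfficient μ
        (fun N ω => WithLp.toLp 2 (MultiCoset.stack
          (MultiCoset.noncompressiveC L c a₀ (MultiCoset.sampleCorr z N ω))))
        (fun R => WithLp.toLp 2 (MultiCoset.stack (MultiCoset.noncompressiveC L c a₀ R)))
        (MultiCoset.corrMatrix z μ)) := by
  have hq : 0 < q := lt_of_le_of_lt (Nat.zero_le _) a₀.2
  have hsnap : ∀ n, Measurable (MultiCoset.snapshot z n) := fun n =>
    measurable_pi_lambda _ fun i => hz i n
  have hlaw := MultiCoset.snapshot_map_eq_gaussLaw hW hL0 hx hP hz hdelay hR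
  have hu := MultiCoset.corrVec_corrMatrix hW hL hL0 hx hP hband hdelay a₀
  have hpos := MultiCoset.ae_average_vecMulVec_posDef hq hsnap hindep hR hlaw
  have hmle : ∀ᵐ ω ∂μ, ∀ N : ℕ, q ≤ N → ∀ R' : Matrix (Fin q) (Fin q) ℝ,
      MultiCoset.IsMLE (MultiCoset.logLik N (fun n => MultiCoset.snapshot z n ω)) R' ↔
        R' = MultiCoset.sampleCorr z N ω := by
    filter_upwards [hpos] with ω hω N hN R'
    exact MultiCoset.isMLE_iff_eq (by omega) _ (hω N hN) R'
  refine ⟨hlaw, hu, MultiCoset.noncompressive_of_corrVec_eq hrank hu, ?_,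
    MultiCoset.isAsymptoticallyEfficient_of_isLinearMap hsnap hindep hR hlaw
      (MultiCoset.isLinearMap_noncompressive a₀), fun hrankC =>
    ⟨MultiCoset.noncompressiveC_of_corrVec_eq hrankC hu, ?_,
      MultiCoset.isAsymptoticallyEfficient_of_isLinearMap hsnap hindep hR hlaw
        (MultiCoset.isLinearMap_stack_noncompressiveC a₀)⟩⟩
  · filter_upwards [hmle] with ω hω N hN
    have hS := (hω N hN _).2 rfl
    exact ⟨hS, fun R' => (hω N hN R').1, hS.isMLEOf _, hS.isMLEOf _⟩
  · filter_upwards [hmle] with ω hω N hN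
    exact ((hω N hN _).2 rfl).isMLEOf _
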